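/- Let $X$ be a spectrally negative Lévy process without monotone paths, with Laplace exponent \[ \psi(\lambda)=-\mu\lambda+\frac{\sigma^2}{2}\lambda^2+\int_{(-\infty,0)}\bigl(e^{\lambda x}-1-\lambda x\mathbf 1_{\{|x|<1\}}\bigr)\,\Pi(dx),\qquad \lambda\ge 0, \] where $\mu,\sigma\in\mathbb R$ and $\Pi$ is a measure carried by $(-\infty,0)$ with $\int(1\wedge x^2)\,\Pi(dx)<\infty$. For $q\ge 0$ let $\Phi(q)=\sup\{\lambda\ge 0:\psi(\lambda)=q\}$, and let $W^{(q)}:\mathbb R\to[0,\infty)$ be the $q$-scale function of $X$: the function that vanishes on $(-\infty,0)$, is right continuous on $[0,\infty)$ and satisfies $\int_0^\infty e^{-\beta x}W^{(q)}(x)\,dx=1/(\psi(\beta)-q)$ for all $\beta>\Phi(q)$. When $\sigma=0$ and $\int_{(-1,0)}|x|\,\Pi(dx)<\infty$, so that $X$ has paths of bounded variation, write $X_t=\delta t-S_t$ with $S$ a pure jump subordinator and $\delta=-\mu-\int_{(-1,0)}x\,\Pi(dx)>0$. Then for every $q\ge 0$ the right derivative $W^{(q)\prime}(0+)=\lim_{x\downarrow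 0}\bigl(W^{(q)}(x)-W^{(q)}(0)\bigr)/x$ exists in $[0,\infty]$, and \[ W^{(q)\prime}(0+)=\begin{cases}2/\sigma^2,&\text{if }\sigma\ne 0\text{ or }\Pi(-\infty,0)=\infty,\\[2pt] \bigl(\Pi(-\infty,0)+q\bigr)/\delta^2,&\text{if }\sigma=0\text{ and }\Pi(-\infty,0)<\infty,\end{cases} \] where the first case is understood to be $+\infty$ when $\sigma=0$. -/

import Mathlib

open MeasureTheory Set Filter Topology

noncomputable section

/-- The law of a (real) spectrally negative Lévy process whose paths are not monotone, given by its
Lévy–Khintchine triplet `(μ, σ, Π)`, for the truncation function `x 𝟙_{|x| < 1}`. -/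
structure SpectrallyNegativeLevy where
  /-- the linear coefficient `μ` of the characteristic exponent -/
  mu : ℝ
  /-- the Gaussian coefficient `σ` -/
  sigma : ℝ
  /-- the Lévy measure `Π` -/
  jump : Measure ℝ
  /-- `Π` is carried by `(-∞, 0)`: no mass at `0` and no positive jumps -/
  jump_Ici : jump (Ici 0) = 0
  /-- `∫ (1 ∧ x²) Π(dx) < ∞` -/
  lintegral_jump_lt_top : ∫⁻ x, ENNReal.ofReal (min 1 (x ^ 2)) ∂jump < ⊤
  /-- The paths are not monotone. Either they have unbounded variation (`σ ≠ 0` or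
  `∫_{(-1,0)} |x| Π(dx) = ∞`), or the process is a strictly positive linear drift minus a nonzero
  pure jump subordinator. What is excluded is the case of bounded variation with either no jumps
  (a pure drift) or a nonpositive drift (a descending subordinator). -/
  not_monotone : sigma ≠ 0 ∨ ∫⁻ x in Ioo (-1) 0, ENNReal.ofReal |x| ∂jump = ⊤ ∨
    (0 < -mu - ∫ x in Ioo (-1) 0, x ∂jump ∧ jump ≠ 0)

namespace SpectrallyNegativeLevy

/-- The Laplace exponent
`ψ(l) = -μ l + σ² l² / 2 + ∫_{(-∞,0)} (e^{l x} - 1 - l x 𝟙_{|x| < 1}) Π(dx)`, for `l ≥ 0`;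
it satisfies `E[exp (l X_t)] = exp (t ψ(l))`. -/
def laplaceExponent (X : SpectrallyNegativeLevy) (l : ℝ) : ℝ :=
  -X.mu * l + X.sigma ^ 2 / 2 * l ^ 2 +
    ∫ x in Iio 0, (Real.exp (l * x) - 1 - l * x * indicator {y : ℝ | |y| < 1} 1 x) ∂X.jump

/-- `Φ(q) = sup {l ≥ 0 : ψ(l) = q}`. -/
def rightInverse (X : SpectrallyNegativeLevy) (q : ℝ) : ℝ :=
  sSup {l : ℝ | 0 ≤ l ∧ X.laplaceExponent l = q}

/-- The drift `δ = -μ - ∫_{(-1,0)} x Π(dx)` in the decomposition `X_t = δ t - S_t` of a process of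
bounded variation (`σ = 0` and `∫_{(-1,0)} |x| Π(dx) < ∞`), where `S` is a pure jump subordinator;
then `ψ(l) = δ l - ∫_{(-∞,0)} (1 - e^{l x}) Π(dx)`. It is only used for such processes. -/
def drift (X : SpectrallyNegativeLevy) : ℝ :=
  -X.mu - ∫ x in Ioo (-1) 0, x ∂X.jump

/-- `W` is the `q`-scale function of `X`: it takes values in `[0, ∞)`, vanishes on `(-∞, 0)`, is
right continuous on `[0, ∞)`, and has the (convergent) Laplace transform `1 / (ψ(β) - q)` for all
`β > Φ(q)`. These properties determine `W`. -/
structure IsScaleFunction (X : SpectrallyNegativeLevy) (q : ℝ) (W : ℝ → ℝ) : Prop where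
  nonneg : ∀ x, 0 ≤ W x
  eq_zero_of_neg : ∀ x < 0, W x = 0
  rightContinuous : ∀ x, 0 ≤ x → ContinuousWithinAt W (Ici x) x
  integrableOn : ∀ b, X.rightInverse q < b →
    IntegrableOn (fun x => Real.exp (-b * x) * W x) (Ioi 0)
  laplace_eq : ∀ b, X.rightInverse q < b →
    ∫ x in Ioi 0, Real.exp (-b * x) * W x = 1 / (X.laplaceExponent b - q)

end SpectrallyNegativeLevy

end

/-!
Dividing `ψ(b) - q` by `b` (bounded variation) or by `b²` and separating the terms by their sign
turns the Laplace transform identity for `W` into a renewal equation with nonnegative kernels: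
`δ W = 1 + k ∗ W`, respectively `σ² W / 2 + l ∗ W = x + r ∗ W`. The behaviour of `W` at `0` is then
read off from that of the kernels: `k (0+) = Π(-∞, 0) + q`, and `∫_0^x l`, `∫_0^x r` tend to `0`
with `x`. The only case in which this is not enough is that of unbounded variation with `σ = 0`,
where `x ≤ l ∗ W` gives `W x / x ≥ 1 / ∫_0^x l` provided that `W` is nondecreasing. To see this,
remove the jumps of size at most `ε`: the scale function becomes the Neumann series of a renewal
equation, which is nondecreasing, and its Laplace transform converges to that of `W` as `ε → 0`.
-/

noncomputable section

open scoped ENNReal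

/-- The Laplace transform `b ↦ ∫_{(0, ∞)} e^{-b x} f(x) dx` of a nonnegative function. It takes
values in `ℝ≥0∞`, so that no convergence has to be assumed. -/
def laplaceTransform (f : ℝ → ℝ≥0∞) (b : ℝ) : ℝ≥0∞ :=
  ∫⁻ x in Ioi 0, ENNReal.ofReal (Real.exp (-b * x)) * f x

/-- The convolution of the restrictions to `(0, ∞)` of two nonnegative functions. -/
def halfLineConv (f g : ℝ → ℝ≥0∞) (x : ℝ) : ℝ≥0∞ :=
  ∫⁻ y in Ioo 0 x, f y * g (x - y)

local infixl:67 " ⋆₊ " => halfLineConv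

section LaplaceTransform

variable {f g : ℝ → ℝ≥0∞} {b : ℝ}

theorem laplaceTransform_eq_lintegral_indicator (f : ℝ → ℝ≥0∞) (b : ℝ) :
    laplaceTransform f b = ∫⁻ x, ENNReal.ofReal (Real.exp (-b * x)) * (Ioi 0).indicator f x := by
  rw [laplaceTransform, ← lintegral_indicator measurableSet_Ioi]
  refine lintegral_congr fun x => ?_
  by_cases hx : 0 < x <;> simp [hx]

theorem laplaceTransform_add (hf : Measurable f) (g : ℝ → ℝ≥0∞) (b : ℝ) :
    laplaceTransform (fun x => f x + g x) b = laplaceTransform f b + laplaceTransform g b := by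
  unfold laplaceTransform
  rw [← lintegral_add_left (by fun_prop)]
  simp only [mul_add]

theorem laplaceTransform_const_mul (hf : Measurable f) (c : ℝ≥0∞) (b : ℝ) :
    laplaceTransform (fun x => c * f x) b = c * laplaceTransform f b := by
  unfold laplaceTransform
  rw [← lintegral_const_mul _ (by fun_prop)]
  simp only [mul_left_comm]

theorem laplaceTransform_tsum {ι : Type*} [Countable ι] {fs : ι → ℝ → ℝ≥0∞}
    (hfs : ∀ i, Measurable (fs i)) (b : ℝ) :
    laplaceTransform (fun x => ∑' i, fs i x) b = ∑' i, laplaceTransform (fs i) b := by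
  unfold laplaceTransform
  rw [← lintegral_tsum fun i => by fun_prop]
  simp only [ENNReal.tsum_mul_left]

theorem laplaceTransform_lintegral {α : Type*} [MeasurableSpace α] {P : Measure α} [SFinite P]
    {H : α → ℝ → ℝ≥0∞} (hH : Measurable (Function.uncurry H)) (b : ℝ) :
    laplaceTransform (fun y => ∫⁻ x, H x y ∂P) b = ∫⁻ x, laplaceTransform (H x) b ∂P := by
  unfold laplaceTransform
  rw [lintegral_lintegral_swap (by fun_prop)]
  exact lintegral_congr fun y => (lintegral_const_mul _ (by fun_prop)).symm

theorem laplaceTransform_congr (h : ∀ x, 0 < x → f x = g x) (b : ℝ) :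
    laplaceTransform f b = laplaceTransform g b :=
  setLIntegral_congr_fun measurableSet_Ioi fun x hx => by rw [h x hx]

theorem laplaceTransform_antitone (f : ℝ → ℝ≥0∞) : Antitone (laplaceTransform f) := by
  intro a b hab
  refine setLIntegral_mono' measurableSet_Ioi fun x (hx : 0 < x) => ?_
  gcongr

theorem laplaceTransform_ne_top_of_le {b' : ℝ} (hf : laplaceTransform f b ≠ ⊤) (hb : b ≤ b') :
    laplaceTransform f b' ≠ ⊤ :=
  ne_top_of_le_ne_top hf (laplaceTransform_antitone f hb)

theorem laplaceTransform_one (hb : 0 < b) :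
    laplaceTransform (fun _ => 1) b = ENNReal.ofReal (1 / b) := by
  simp only [laplaceTransform, mul_one]
  rw [← ofReal_integral_eq_lintegral_ofReal (integrableOn_exp_mul_Ioi (by linarith) 0)
    (ae_of_all _ fun x => (Real.exp_pos _).le), integral_exp_mul_Ioi (by linarith)]
  simp

theorem laplaceTransform_const (hb : 0 < b) (c : ℝ≥0∞) :
    laplaceTransform (fun _ => c) b = c * ENNReal.ofReal (1 / b) := by
  simpa [laplaceTransform_one hb] using
    laplaceTransform_const_mul (f := fun _ => 1) measurable_const c b

theorem tendsto_laplaceTransform_atTop (hf : Measurable f) (hb : laplaceTransform f b ≠ ⊤) :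
    Tendsto (laplaceTransform f) atTop (𝓝 0) := by
  have hfin : ∀ᵐ x ∂volume.restrict (Ioi (0 : ℝ)), f x ≠ ⊤ := by
    filter_upwards [ae_lt_top (by fun_prop) hb] with x hx h
    simp [h, Real.exp_pos] at hx
  rw [← lintegral_zero (μ := volume.restrict (Ioi (0 : ℝ)))]
  refine tendsto_lintegral_filter_of_dominated_convergence
    (fun x => ENNReal.ofReal (Real.exp (-b * x)) * f x)
    (Eventually.of_forall fun c => by fun_prop) ?_ hb ?_
  · filter_upwards [eventually_ge_atTop b] with c hc
    filter_upwards [ae_restrict_mem measurableSet_Ioi] with x (hx : 0 < x)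
    gcongr
  · filter_upwards [hfin, ae_restrict_mem measurableSet_Ioi] with x hx hx0
    have hexp : Tendsto (fun c : ℝ => ENNReal.ofReal (Real.exp (-c * x))) atTop (𝓝 0) := by
      rw [← ENNReal.ofReal_zero]
      exact ENNReal.tendsto_ofReal (Real.tendsto_exp_atBot.comp
        (tendsto_neg_atTop_atBot.atBot_mul_const hx0))
    simpa using ENNReal.Tendsto.mul_const hexp (Or.inr hx)

theorem setLIntegral_Ioo_ne_top_of_laplaceTransform_ne_top (hf : laplaceTransform f b ≠ ⊤)
    (u : ℝ) : ∫⁻ x in Ioo 0 u, f x ≠ ⊤ := by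
  have hbound : ∫⁻ x in Ioo 0 u, f x ≤
      ENNReal.ofReal (Real.exp (|b| * u)) * laplaceTransform f b := by
    rw [laplaceTransform, ← lintegral_const_mul' _ _ ENNReal.ofReal_ne_top]
    refine (setLIntegral_mono' measurableSet_Ioo fun x hx => ?_).trans
      (lintegral_mono_set Ioo_subset_Ioi_self)
    rw [← mul_assoc, ← ENNReal.ofReal_mul (Real.exp_pos _).le, ← Real.exp_add]
    refine le_mul_of_one_le_left zero_le ?_
    rw [ENNReal.one_le_ofReal, Real.one_le_exp_iff]
    nlinarith [hx.1, hx.2, le_abs_self b, abs_nonneg b]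
  exact ne_top_of_le_ne_top (ENNReal.mul_ne_top ENNReal.ofReal_ne_top hf) hbound

end LaplaceTransform

section HalfLineConv

variable {f g : ℝ → ℝ≥0∞}

theorem halfLineConv_eq_lconvolution (f g : ℝ → ℝ≥0∞) :
    f ⋆₊ g = lconvolution ((Ioi 0).indicator f) ((Ioi 0).indicator g) volume := by
  ext x
  rw [halfLineConv, lconvolution, ← lintegral_indicator measurableSet_Ioo]
  refine lintegral_congr fun y => ?_
  by_cases h1 : 0 < y <;> by_cases h2 : y < x <;> simp [h1, h2, neg_add_eq_sub]

@[fun_prop]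
theorem measurable_halfLineConv (hf : Measurable f) (hg : Measurable g) :
    Measurable (f ⋆₊ g) := by
  rw [halfLineConv_eq_lconvolution]
  exact measurable_lconvolution _ (hf.indicator measurableSet_Ioi) (hg.indicator measurableSet_Ioi)

theorem laplaceTransform_halfLineConv (hf : Measurable f) (hg : Measurable g) (b : ℝ) :
    laplaceTransform (f ⋆₊ g) b = laplaceTransform f b * laplaceTransform g b := by
  have hf' := hf.indicator (measurableSet_Ioi (a := (0 : ℝ)))
  have hg' := hg.indicator (measurableSet_Ioi (a := (0 : ℝ)))
  have hzero (x : ℝ) : (Ioi 0).indicator (f ⋆₊ g) x = (f ⋆₊ g) x := by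
    by_cases hx : 0 < x <;> simp [hx, halfLineConv]
  have hexp (x y : ℝ) : ENNReal.ofReal (Real.exp (-b * x)) =
      ENNReal.ofReal (Real.exp (-b * y)) * ENNReal.ofReal (Real.exp (-b * (-y + x))) := by
    rw [← ENNReal.ofReal_mul (Real.exp_pos _).le, ← Real.exp_add]
    ring_nf
  simp only [laplaceTransform_eq_lintegral_indicator, hzero]
  calc ∫⁻ x, ENNReal.ofReal (Real.exp (-b * x)) * (f ⋆₊ g) x
      = ∫⁻ x, ∫⁻ y, (ENNReal.ofReal (Real.exp (-b * y)) * (Ioi 0).indicator f y) *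
          (ENNReal.ofReal (Real.exp (-b * (-y + x))) * (Ioi 0).indicator g (-y + x)) := by
        refine lintegral_congr fun x => ?_
        rw [halfLineConv_eq_lconvolution, lconvolution, ← lintegral_const_mul _ (by fun_prop)]
        refine lintegral_congr fun y => ?_
        rw [hexp x y]
        ring
    _ = ∫⁻ y, ∫⁻ x, (ENNReal.ofReal (Real.exp (-b * y)) * (Ioi 0).indicator f y) *
          (ENNReal.ofReal (Real.exp (-b * (-y + x))) * (Ioi 0).indicator g (-y + x)) :=
        lintegral_lintegral_swap (by fun_prop)
    _ = ∫⁻ y, (ENNReal.ofReal (Real.exp (-b * y)) * (Ioi 0).indicator f y) *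
          ∫⁻ x, ENNReal.ofReal (Real.exp (-b * x)) * (Ioi 0).indicator g x := by
        refine lintegral_congr fun y => ?_
        rw [lintegral_const_mul _ (by fun_prop), lintegral_add_left_eq_self
          (fun x => ENNReal.ofReal (Real.exp (-b * x)) * (Ioi 0).indicator g x)]
    _ = _ := lintegral_mul_const _ (by fun_prop)

theorem halfLineConv_one_one (x : ℝ) : ((fun _ => 1) ⋆₊ fun _ => 1) x = ENNReal.ofReal x := by
  simp [halfLineConv]

theorem laplaceTransform_ofReal {b : ℝ} (hb : 0 < b) :
    laplaceTransform ENNReal.ofReal b = ENNReal.ofReal (1 / b ^ 2) := by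
  have h : (ENNReal.ofReal : ℝ → ℝ≥0∞) = (fun _ => 1) ⋆₊ fun _ => 1 :=
    (funext halfLineConv_one_one).symm
  rw [congrArg laplaceTransform h, laplaceTransform_halfLineConv measurable_const
    measurable_const, laplaceTransform_one hb, ← ENNReal.ofReal_mul (by positivity)]
  congr 1
  field_simp

theorem halfLineConv_monotone (f : ℝ → ℝ≥0∞) (hg : Monotone g) : Monotone (f ⋆₊ g) := by
  intro x y hxy
  calc (f ⋆₊ g) x ≤ ∫⁻ z in Ioo 0 x, f z * g (y - z) :=
        lintegral_mono fun z => mul_le_mul_right (hg (sub_le_sub_right hxy z)) _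
    _ ≤ (f ⋆₊ g) y := lintegral_mono_set (Ioo_subset_Ioo_right hxy)

theorem halfLineConv_le_mul (hf : Measurable f) {x : ℝ} {C : ℝ≥0∞} (hg : ∀ y ∈ Ioo 0 x, g y ≤ C) :
    (f ⋆₊ g) x ≤ (∫⁻ y in Ioo 0 x, f y) * C := by
  rw [← lintegral_mul_const _ hf]
  refine setLIntegral_mono' measurableSet_Ioo fun y hy => mul_le_mul_right ?_ _
  exact hg (x - y) ⟨sub_pos.2 hy.2, sub_lt_self x hy.1⟩

theorem mul_le_halfLineConv (hf : Measurable f) {x : ℝ} {C : ℝ≥0∞} (hg : ∀ y ∈ Ioo 0 x, C ≤ g y) :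
    (∫⁻ y in Ioo 0 x, f y) * C ≤ (f ⋆₊ g) x := by
  rw [← lintegral_mul_const _ hf]
  refine setLIntegral_mono' measurableSet_Ioo fun y hy => mul_le_mul_right ?_ _
  exact hg (x - y) ⟨sub_pos.2 hy.2, sub_lt_self x hy.1⟩

theorem halfLineConv_eq_setLIntegral_indicator (f g : ℝ → ℝ≥0∞) {x u : ℝ} (hx : x < u) :
    (f ⋆₊ g) x = ∫⁻ y in Ioo 0 u, (Iio x).indicator (fun y => f y * g (x - y)) y := by
  rw [halfLineConv, lintegral_indicator measurableSet_Iio,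
    Measure.restrict_restrict measurableSet_Iio, inter_comm, Ioo_inter_Iio, min_eq_right hx.le]

theorem continuousWithinAt_halfLineConv {x u : ℝ} {C : ℝ≥0∞} (hf : Measurable f)
    (hfu : ∫⁻ y in Ioo 0 u, f y ≠ ⊤) (hg : Measurable g) (hC : C ≠ ⊤)
    (hgC : ∀ y ∈ Ioo 0 u, g y ≤ C) (hgr : ∀ y ∈ Ioo 0 u, ContinuousWithinAt g (Ioi y) y)
    (hx : x ∈ Ioo 0 u) : ContinuousWithinAt (f ⋆₊ g) (Ioi x) x := by
  have hfin : ∀ᵐ y ∂volume.restrict (Ioo 0 u), f y ≠ ⊤ :=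
    (ae_lt_top hf hfu).mono fun y hy => hy.ne
  have hne : ∀ᵐ y ∂volume.restrict (Ioo 0 u), y ≠ x := ae_restrict_of_ae (Measure.ae_ne volume x)
  rw [ContinuousWithinAt, halfLineConv_eq_setLIntegral_indicator f g hx.2]
  have hlt : ∀ᶠ z in 𝓝[>] x, z < u := mem_of_superset (Ioo_mem_nhdsGT hx.2) Ioo_subset_Iio_self
  refine Tendsto.congr'
    (hlt.mono fun z hz => (halfLineConv_eq_setLIntegral_indicator f g hz).symm) ?_
  refine tendsto_lintegral_filter_of_dominated_convergence (fun y => f y * C)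
    (Eventually.of_forall fun z => Measurable.indicator (by fun_prop) measurableSet_Iio) ?_ ?_ ?_
  · filter_upwards [hlt] with z hz
    filter_upwards [ae_restrict_mem measurableSet_Ioo] with y hy
    by_cases hyz : y < z
    · rw [indicator_of_mem (show y ∈ Iio z from hyz)]
      exact mul_le_mul_right (hgC (z - y) ⟨sub_pos.2 hyz, by linarith [hy.1]⟩) _
    · simp [hyz]
  · rw [lintegral_mul_const _ hf]
    exact ENNReal.mul_ne_top hfu hC
  · filter_upwards [hfin, hne, ae_restrict_mem measurableSet_Ioo] with y hfy hyx hy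
    rcases hyx.lt_or_gt with hyx | hyx
    · have hshift : Tendsto (fun z => z - y) (𝓝[>] x) (𝓝[>] (x - y)) :=
        tendsto_nhdsWithin_iff.2 ⟨((continuous_sub_right y).tendsto x).mono_left
          nhdsWithin_le_nhds, by filter_upwards [self_mem_nhdsWithin] with z hz
            using sub_lt_sub_right hz y⟩
      have hgxy := (hgr (x - y) ⟨sub_pos.2 hyx, by linarith [hy.1, hx.2]⟩).tendsto.comp hshift
      rw [indicator_of_mem (show y ∈ Iio x from hyx)]
      refine (ENNReal.Tendsto.const_mul hgxy (Or.inr hfy)).congr' ?_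
      filter_upwards [self_mem_nhdsWithin] with z hz
      rw [indicator_of_mem (show y ∈ Iio z from hyx.trans hz), Function.comp_apply]
    · refine tendsto_const_nhds.congr' ?_
      filter_upwards [Ioo_mem_nhdsGT hyx] with z hz
      rw [indicator_of_notMem (show y ∉ Iio x from hyx.not_gt),
        indicator_of_notMem (show y ∉ Iio z from hz.2.not_gt)]

end HalfLineConv

section WeakConvergence

variable {ι : Type*} {l : Filter ι}

theorem integrable_of_continuous_of_ae_mem_Icc {μ : Measure ℝ} [IsFiniteMeasure μ] {a b : ℝ}
    (hμ : ∀ᵐ t ∂μ, t ∈ Icc a b) {φ : ℝ → ℝ} (hφ : Continuous φ) : Integrable φ μ := by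
  obtain ⟨C, hC⟩ := isCompact_Icc.exists_bound_of_continuousOn (hφ.continuousOn (s := Icc a b))
  exact Integrable.of_bound hφ.aestronglyMeasurable C (hμ.mono hC)

theorem integral_polynomial_eval {μ : Measure ℝ} [IsFiniteMeasure μ] {a b : ℝ}
    (hμ : ∀ᵐ t ∂μ, t ∈ Icc a b) (p : Polynomial ℝ) :
    ∫ t, p.eval t ∂μ = ∑ j ∈ Finset.range (p.natDegree + 1), p.coeff j * ∫ t, t ^ j ∂μ := by
  simp only [Polynomial.eval_eq_sum_range]
  rw [integral_finsetSum _ fun j _ => integrable_of_continuous_of_ae_mem_Icc hμ (by fun_prop)]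
  simp only [integral_const_mul]

theorem abs_integral_sub_integral_le {μ : Measure ℝ} [IsFiniteMeasure μ] {a b C : ℝ}
    (hμ : ∀ᵐ t ∂μ, t ∈ Icc a b) {φ χ : ℝ → ℝ} (hφ : Continuous φ) (hχ : Continuous χ)
    (hC : ∀ t ∈ Icc a b, |φ t - χ t| ≤ C) :
    |∫ t, φ t ∂μ - ∫ t, χ t ∂μ| ≤ C * μ.real univ := by
  rw [← integral_sub (integrable_of_continuous_of_ae_mem_Icc hμ hφ)
    (integrable_of_continuous_of_ae_mem_Icc hμ hχ)]
  exact norm_integral_le_of_norm_le_const (f := fun t => φ t - χ t) (hμ.mono hC)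

theorem tendsto_finiteMeasure_of_tendsto_moments {μs : ι → FiniteMeasure ℝ} {μ : FiniteMeasure ℝ}
    {a b : ℝ} (hμs : ∀ i, ∀ᵐ t ∂(μs i : Measure ℝ), t ∈ Icc a b)
    (hμ : ∀ᵐ t ∂(μ : Measure ℝ), t ∈ Icc a b)
    (h : ∀ j : ℕ, Tendsto (fun i => ∫ t, t ^ j ∂(μs i : Measure ℝ)) l
      (𝓝 (∫ t, t ^ j ∂(μ : Measure ℝ)))) :
    Tendsto μs l (𝓝 μ) := by
  refine FiniteMeasure.tendsto_iff_forall_integral_tendsto.2 fun φ => Metric.tendsto_nhds.2 ?_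
  intro ε hε
  set m := (μ : Measure ℝ).real univ
  have hm : 0 < m + 1 := by positivity
  have hmass : ∀ᶠ i in l, (μs i : Measure ℝ).real univ < m + 1 := by
    have := h 0
    simp only [pow_zero, integral_const, smul_eq_mul, mul_one] at this
    exact this.eventually_lt_const (lt_add_one m)
  obtain ⟨p, hp⟩ := exists_polynomial_near_of_continuousOn a b φ φ.continuous.continuousOn
    (ε / (4 * (m + 1))) (by positivity)
  have hclose {ν : Measure ℝ} [IsFiniteMeasure ν] (hν : ∀ᵐ t ∂ν, t ∈ Icc a b)
      (hνm : ν.real univ < m + 1) : |∫ t, p.eval t ∂ν - ∫ t, φ t ∂ν| ≤ ε / 4 :=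
    calc _ ≤ ε / (4 * (m + 1)) * ν.real univ :=
          abs_integral_sub_integral_le hν p.continuous φ.continuous fun t ht => (hp t ht).le
      _ ≤ ε / (4 * (m + 1)) * (m + 1) := by gcongr
      _ = ε / 4 := by field_simp
  have hpoly : Tendsto (fun i => ∫ t, p.eval t ∂(μs i : Measure ℝ)) l
      (𝓝 (∫ t, p.eval t ∂(μ : Measure ℝ))) := by
    simp only [integral_polynomial_eval hμ, fun i => integral_polynomial_eval (hμs i)]
    exact tendsto_finsetSum _ fun j _ => (h j).const_mul _
  filter_upwards [hmass, Metric.tendsto_nhds.1 hpoly (ε / 4) (by positivity)] with i hi hi'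
  have hs := abs_le.1 (hclose (hμs i) hi)
  have hlim := abs_le.1 (hclose hμ (lt_add_one m))
  rw [Real.dist_eq, abs_lt] at hi' ⊢
  constructor <;> linarith

theorem tendsto_finiteMeasure_apply_of_null_frontier {Ω : Type*} [TopologicalSpace Ω]
    [MeasurableSpace Ω] [OpensMeasurableSpace Ω] [HasOuterApproxClosed Ω]
    {μs : ι → FiniteMeasure Ω} {μ : FiniteMeasure Ω} (h : Tendsto μs l (𝓝 μ)) {E : Set Ω}
    (hE : μ (frontier E) = 0) : Tendsto (fun i => μs i E) l (𝓝 (μ E)) := by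
  have hmass := h.mass
  rcases eq_or_ne μ 0 with rfl | hμ
  · rw [FiniteMeasure.zero_mass] at hmass
    exact tendsto_of_tendsto_of_tendsto_of_le_of_le tendsto_const_nhds hmass (fun _ => zero_le)
      fun i => FiniteMeasure.apply_le_mass _ _
  · have : Nonempty Ω := by
      by_contra hΩ
      rw [not_nonempty_iff] at hΩ
      exact hμ (Subtype.ext (Measure.eq_zero_of_isEmpty _))
    have hnormalize := ProbabilityMeasure.tendsto_measure_of_null_frontier_of_tendsto
      (FiniteMeasure.tendsto_normalize_of_tendsto h hμ) (E := E) (by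
        rw [μ.normalize_eq_of_nonzero hμ, hE, mul_zero])
    simp only [FiniteMeasure.self_eq_mass_mul_normalize]
    exact hmass.mul hnormalize

end WeakConvergence

section RightContinuous

theorem measurable_of_continuousWithinAt_Ioi {β : Type*} [TopologicalSpace β]
    [TopologicalSpace.PseudoMetrizableSpace β] [MeasurableSpace β] [BorelSpace β] {f : ℝ → β}
    (hf : ∀ x, ContinuousWithinAt f (Ioi x) x) : Measurable f := by
  have hpos (n : ℕ) : 0 < (n : ℝ) + 1 := n.cast_add_one_pos
  refine measurable_of_tendsto_metrizable
    (f := fun (n : ℕ) x => f ((⌊((n : ℝ) + 1) * x⌋ + 1 : ℤ) / ((n : ℝ) + 1))) (fun n => ?_)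
    (tendsto_pi_nhds.2 fun x => ?_)
  · exact (measurable_from_top (f := fun m : ℤ => f ((m + 1 : ℤ) / ((n : ℝ) + 1)))).comp
      (Int.measurable_floor.comp (measurable_const_mul _))
  have hgt (n : ℕ) : x < (⌊((n : ℝ) + 1) * x⌋ + 1 : ℤ) / ((n : ℝ) + 1) := by
    rw [lt_div_iff₀ (hpos n), mul_comm]
    push_cast
    exact Int.lt_floor_add_one _
  have hle (n : ℕ) : (⌊((n : ℝ) + 1) * x⌋ + 1 : ℤ) / ((n : ℝ) + 1) ≤ x + 1 / ((n : ℝ) + 1) := by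
    rw [div_le_iff₀ (hpos n), add_mul x, one_div_mul_cancel (hpos n).ne', mul_comm x]
    push_cast
    gcongr
    exact Int.floor_le _
  refine (hf x).tendsto.comp (tendsto_nhdsWithin_iff.2 ⟨?_, Eventually.of_forall hgt⟩)
  refine tendsto_of_tendsto_of_tendsto_of_le_of_le tendsto_const_nhds ?_ (fun n => (hgt n).le) hle
  simpa using (tendsto_one_div_add_atTop_nhds_zero_nat (𝕜 := ℝ)).const_add x

theorem frequently_nhdsGT_of_ae {a b x : ℝ} {p : ℝ → Prop}
    (hp : ∀ᵐ y ∂volume.restrict (Ioo a b), p y) (hx : x ∈ Ico a b) : ∃ᶠ y in 𝓝[>] x, p y := by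
  intro h
  obtain ⟨u, hu, hsub⟩ := mem_nhdsGT_iff_exists_Ioo_subset.1 (h.and (Ioo_mem_nhdsGT hx.2))
  have hnull : volume (Ioo x u) = 0 := by
    refine measure_mono_null (fun y hy => ?_) (ae_iff.1 ((ae_restrict_iff' measurableSet_Ioo).1 hp))
    exact fun hy' => (hsub hy).1 (hy' ⟨hx.1.trans_lt hy.1, (hsub hy).2.2⟩)
  rw [Real.volume_Ioo, ENNReal.ofReal_eq_zero, sub_nonpos] at hnull
  exact hnull.not_gt hu

theorem eqOn_of_ae_eq_of_continuousWithinAt_Ioi {β : Type*} [TopologicalSpace β] [T2Space β]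
    {f g : ℝ → β} {a b : ℝ} (h : f =ᵐ[volume.restrict (Ioo a b)] g)
    (hf : ∀ x ∈ Ioo a b, ContinuousWithinAt f (Ioi x) x)
    (hg : ∀ x ∈ Ioo a b, ContinuousWithinAt g (Ioi x) x) : EqOn f g (Ioo a b) := fun x hx =>
  tendsto_nhds_unique_of_frequently_eq (hf x hx) (hg x hx)
    (frequently_nhdsGT_of_ae h (Ioo_subset_Ico_self hx))

theorem tendsto_biSup_Ioo_nhdsGT {β : Type*} [CompleteLinearOrder β] [DenselyOrdered β]
    [TopologicalSpace β] [OrderTopology β] {g : ℝ → β} {a : ℝ} {c : β}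
    (hg : Tendsto g (𝓝[>] a) (𝓝 c)) : Tendsto (fun x => ⨆ y ∈ Ioo a x, g y) (𝓝[>] a) (𝓝 c) := by
  refine tendsto_order.2 ⟨fun p hp => ?_, fun p hp => ?_⟩
  · obtain ⟨u, hu, hsub⟩ := mem_nhdsGT_iff_exists_Ioo_subset.1 (hg.eventually_const_lt hp)
    filter_upwards [Ioo_mem_nhdsGT hu] with x hx
    obtain ⟨y, hay, hyx⟩ := exists_between hx.1
    exact (hsub ⟨hay, hyx.trans hx.2⟩).trans_le (le_biSup g ⟨hay, hyx⟩)
  · obtain ⟨p', hp', hpp'⟩ := exists_between hp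
    obtain ⟨u, hu, hsub⟩ := mem_nhdsGT_iff_exists_Ioo_subset.1 (hg.eventually_lt_const hp')
    filter_upwards [Ioo_mem_nhdsGT hu] with x hx
    exact (iSup₂_le fun y hy => (hsub ⟨hy.1, hy.2.trans hx.2⟩).le).trans_lt hpp'

theorem tendsto_biInf_Ioo_nhdsGT {β : Type*} [CompleteLinearOrder β] [DenselyOrdered β]
    [TopologicalSpace β] [OrderTopology β] {g : ℝ → β} {a : ℝ} {c : β}
    (hg : Tendsto g (𝓝[>] a) (𝓝 c)) : Tendsto (fun x => ⨅ y ∈ Ioo a x, g y) (𝓝[>] a) (𝓝 c) :=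
  tendsto_biSup_Ioo_nhdsGT (β := βᵒᵈ) hg

theorem tendsto_setLIntegral_Ioo_div {g : ℝ → ℝ≥0∞} {a : ℝ} {c : ℝ≥0∞}
    (hg : Tendsto g (𝓝[>] a) (𝓝 c)) :
    Tendsto (fun x => (∫⁻ y in Ioo a x, g y) / ENNReal.ofReal (x - a)) (𝓝[>] a) (𝓝 c) := by
  have hconst (p : ℝ≥0∞) {x : ℝ} (hx : a < x) :
      (∫⁻ _ in Ioo a x, p) / ENNReal.ofReal (x - a) = p := by
    rw [setLIntegral_const, Real.volume_Ioo]
    exact ENNReal.mul_div_cancel_right (by simpa using hx) ENNReal.ofReal_ne_top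
  refine tendsto_of_tendsto_of_tendsto_of_le_of_le' (tendsto_biInf_Ioo_nhdsGT hg)
    (tendsto_biSup_Ioo_nhdsGT hg) ?_ ?_
  · filter_upwards [self_mem_nhdsWithin] with x hx
    rw [← hconst (⨅ y ∈ Ioo a x, g y) hx]
    gcongr ?_ / _
    exact setLIntegral_mono' measurableSet_Ioo fun y hy => biInf_le g hy
  · filter_upwards [self_mem_nhdsWithin] with x hx
    rw [← hconst (⨆ y ∈ Ioo a x, g y) hx]
    gcongr ?_ / _
    exact setLIntegral_mono' measurableSet_Ioo fun y hy => le_biSup g hy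

theorem tendsto_setLIntegral_Ioo_nhdsGT {f : ℝ → ℝ≥0∞} {a b : ℝ} (hab : a < b)
    (hf : ∫⁻ x in Ioo a b, f x ≠ ⊤) :
    Tendsto (fun x => ∫⁻ y in Ioo a x, f y) (𝓝[>] a) (𝓝 0) := by
  have hvol : Tendsto (fun x => (volume.restrict (Ioo a b)) (Ioo a x)) (𝓝[>] a) (𝓝 0) := by
    have hsub : Tendsto (fun x => ENNReal.ofReal (x - a)) (𝓝[>] a) (𝓝 0) := by
      have : Continuous fun x => ENNReal.ofReal (x - a) :=
        ENNReal.continuous_ofReal.comp (continuous_sub_right a)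
      simpa using (this.tendsto a).mono_left nhdsWithin_le_nhds
    refine tendsto_of_tendsto_of_tendsto_of_le_of_le tendsto_const_nhds hsub (fun _ => zero_le)
      fun x => ?_
    exact (Measure.restrict_apply_le _ _).trans_eq Real.volume_Ioo
  refine (tendsto_setLIntegral_zero hf hvol).congr' ?_
  filter_upwards [Ioo_mem_nhdsGT hab] with x hx
  rw [Measure.restrict_restrict measurableSet_Ioo, inter_eq_left.2 (Ioo_subset_Ioo_right hx.2.le)]

end RightContinuous

section LaplaceTransformLimits

variable {f g : ℝ → ℝ≥0∞} {b : ℝ} {ι : Type*} {l : Filter ι} {fs : ι → ℝ → ℝ≥0∞}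

/-- The image under `x ↦ e^{-x}` of the measure `e^{-b x} f(x) dx` on `(0, ∞)`. It is carried by
`[0, 1]`, where a finite measure is determined by its moments, and its `j`-th moment is the Laplace
transform of `f` at `b + j`. -/
def expMeasure (f : ℝ → ℝ≥0∞) (b : ℝ) : Measure ℝ :=
  ((volume.restrict (Ioi 0)).withDensity
    fun x => ENNReal.ofReal (Real.exp (-b * x)) * f x).map fun x => Real.exp (-x)

theorem lintegral_expMeasure (hf : Measurable f) (b : ℝ) (hg : Measurable g) :
    ∫⁻ t, g t ∂expMeasure f b =
      ∫⁻ x in Ioi 0, ENNReal.ofReal (Real.exp (-b * x)) * f x * g (Real.exp (-x)) := by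
  rw [expMeasure, lintegral_map hg (by fun_prop),
    lintegral_withDensity_eq_lintegral_mul _ (by fun_prop) (g := fun x => g (Real.exp (-x)))
      (by fun_prop)]
  simp only [Pi.mul_apply]

theorem isFiniteMeasure_expMeasure (hf : Measurable f) (hb : laplaceTransform f b ≠ ⊤) :
    IsFiniteMeasure (expMeasure f b) := by
  constructor
  rw [← lintegral_one, lintegral_expMeasure hf b measurable_const]
  simpa only [mul_one, laplaceTransform] using hb.lt_top

theorem ae_expMeasure_mem_Icc (f : ℝ → ℝ≥0∞) (b : ℝ) :
    ∀ᵐ t ∂expMeasure f b, t ∈ Icc (0 : ℝ) 1 := by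
  rw [expMeasure, ae_map_iff (p := fun t => t ∈ Icc (0 : ℝ) 1) (by fun_prop) measurableSet_Icc]
  refine (withDensity_absolutelyContinuous _ _).ae_le ?_
  filter_upwards [ae_restrict_mem measurableSet_Ioi] with x (hx : 0 < x)
  exact ⟨(Real.exp_pos _).le, Real.exp_le_one_iff.2 (by linarith)⟩

theorem integral_pow_expMeasure (hf : Measurable f) (b : ℝ) (j : ℕ) :
    ∫ t, t ^ j ∂expMeasure f b = (laplaceTransform f (b + j)).toReal := by
  rw [integral_eq_lintegral_of_nonneg_ae
    ((ae_expMeasure_mem_Icc f b).mono fun t ht => pow_nonneg ht.1 j) (by fun_prop),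
    lintegral_expMeasure hf b (by fun_prop), laplaceTransform]
  congr 1
  refine lintegral_congr fun x => ?_
  rw [mul_right_comm, ← ENNReal.ofReal_mul (Real.exp_pos _).le, ← Real.exp_nat_mul, ← Real.exp_add]
  ring_nf

theorem expMeasure_Ioo_exp (f : ℝ → ℝ≥0∞) (b : ℝ) {x : ℝ} (hx : 0 ≤ x) (y : ℝ) :
    expMeasure f b (Ioo (Real.exp (-y)) (Real.exp (-x))) =
      ∫⁻ z in Ioo x y, ENNReal.ofReal (Real.exp (-b * z)) * f z := by
  have hpreimage : (fun z => Real.exp (-z)) ⁻¹' Ioo (Real.exp (-y)) (Real.exp (-x)) = Ioo x y := by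
    ext z
    simp [and_comm]
  rw [expMeasure, Measure.map_apply (by fun_prop) measurableSet_Ioo, hpreimage,
    withDensity_apply _ measurableSet_Ioo, Measure.restrict_restrict measurableSet_Ioo,
    inter_eq_left.2 (show Ioo x y ⊆ Ioi 0 from fun z hz => hx.trans_lt hz.1)]

instance nullSingletonClass_expMeasure (f : ℝ → ℝ≥0∞) (b : ℝ) :
    NullSingletonClass (expMeasure f b) := by
  refine ⟨fun t => ?_⟩
  rw [expMeasure, Measure.map_apply (by fun_prop) (measurableSet_singleton t)]
  refine (withDensity_absolutelyContinuous _ _) (Set.Subsingleton.measure_zero ?_ _)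
  exact subsingleton_singleton.preimage (Real.exp_injective.comp neg_injective)

/-- `expMeasure f b` as a term of `FiniteMeasure ℝ`, the type carrying the topology of weak
convergence. -/
def finiteExpMeasure (hf : Measurable f) (hb : laplaceTransform f b ≠ ⊤) : FiniteMeasure ℝ :=
  ⟨expMeasure f b, isFiniteMeasure_expMeasure hf hb⟩

theorem tendsto_finiteExpMeasure_of_tendsto_laplaceTransform (hfs : ∀ i, Measurable (fs i))
    (hf : Measurable f) (hbs : ∀ i, laplaceTransform (fs i) b ≠ ⊤) (hb : laplaceTransform f b ≠ ⊤)
    (h : ∀ j : ℕ, Tendsto (fun i => laplaceTransform (fs i) (b + j)) l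
      (𝓝 (laplaceTransform f (b + j)))) :
    Tendsto (fun i => finiteExpMeasure (hfs i) (hbs i)) l (𝓝 (finiteExpMeasure hf hb)) := by
  refine tendsto_finiteMeasure_of_tendsto_moments (fun i => ae_expMeasure_mem_Icc _ _)
    (ae_expMeasure_mem_Icc _ _) fun j => ?_
  simp only [finiteExpMeasure, FiniteMeasure.toMeasure_mk, integral_pow_expMeasure hf,
    fun i => integral_pow_expMeasure (hfs i)]
  exact (ENNReal.tendsto_toReal (laplaceTransform_ne_top_of_le hb (by simp))).comp (h j)

theorem ae_eq_of_laplaceTransform_eq (hf : Measurable f) (hg : Measurable g)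
    (hb : laplaceTransform f b ≠ ⊤)
    (h : ∀ j : ℕ, laplaceTransform f (b + j) = laplaceTransform g (b + j)) :
    f =ᵐ[volume.restrict (Ioi 0)] g := by
  have hb' : laplaceTransform g b ≠ ⊤ := by simpa using (h 0).symm.trans_ne (by simpa using hb)
  have heq : expMeasure f b = expMeasure g b := by
    have hlim := tendsto_finiteExpMeasure_of_tendsto_laplaceTransform (l := pure ())
      (fun _ => hf) hg (fun _ => hb) hb' fun j => by rw [h j]; exact tendsto_const_nhds
    exact congrArg FiniteMeasure.toMeasure (tendsto_nhds_unique tendsto_const_nhds hlim)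
  have hmap := congrArg (Measure.map fun t => -Real.log t) heq
  have hid : ((fun t => -Real.log t) ∘ fun x => Real.exp (-x)) = id := by
    ext x
    simp
  rw [expMeasure, expMeasure, Measure.map_map (by fun_prop) (by fun_prop),
    Measure.map_map (by fun_prop) (by fun_prop), hid, Measure.map_id, Measure.map_id] at hmap
  filter_upwards [(withDensity_eq_iff (by fun_prop) (by fun_prop) hb).1 hmap] with x hx
  exact (ENNReal.mul_right_inj (by simp [Real.exp_pos]) ENNReal.ofReal_ne_top).1 hx

theorem tendsto_setLIntegral_Ioo_of_tendsto_laplaceTransform (hfs : ∀ i, Measurable (fs i))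
    (hf : Measurable f) (hbs : ∀ i, laplaceTransform (fs i) b ≠ ⊤) (hb : laplaceTransform f b ≠ ⊤)
    (h : ∀ j : ℕ, Tendsto (fun i => laplaceTransform (fs i) (b + j)) l
      (𝓝 (laplaceTransform f (b + j)))) {x y : ℝ} (hx : 0 ≤ x) (hxy : x < y) :
    Tendsto (fun i => ∫⁻ z in Ioo x y, ENNReal.ofReal (Real.exp (-b * z)) * fs i z) l
      (𝓝 (∫⁻ z in Ioo x y, ENNReal.ofReal (Real.exp (-b * z)) * f z)) := by
  have hfrontier : expMeasure f b (frontier (Ioo (Real.exp (-y)) (Real.exp (-x)))) = 0 := by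
    rw [frontier_Ioo (by simpa using hxy)]
    exact (toFinite _).measure_zero _
  have hlim := tendsto_finiteMeasure_apply_of_null_frontier
    (tendsto_finiteExpMeasure_of_tendsto_laplaceTransform hfs hf hbs hb h)
    (FiniteMeasure.null_iff_toMeasure_null _ _ |>.2 hfrontier)
  have happly {k : ℝ → ℝ≥0∞} (hk : Measurable k) (hkb : laplaceTransform k b ≠ ⊤) :
      (finiteExpMeasure hk hkb (Ioo (Real.exp (-y)) (Real.exp (-x))) : ℝ≥0∞) =
        ∫⁻ z in Ioo x y, ENNReal.ofReal (Real.exp (-b * z)) * k z :=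
    (FiniteMeasure.ennreal_coeFn_eq_coeFn_toMeasure _ _).trans (expMeasure_Ioo_exp k b hx y)
  simpa only [happly] using ENNReal.tendsto_coe.2 hlim

theorem setLIntegral_Ioo_exp_mul_le_of_monotone (hf : Monotone f) (b : ℝ) {h : ℝ} (hh : 0 ≤ h)
    (x y : ℝ) :
    ∫⁻ z in Ioo x y, ENNReal.ofReal (Real.exp (-b * z)) * f z ≤
      ENNReal.ofReal (Real.exp (b * h)) *
        ∫⁻ z in Ioo (x + h) (y + h), ENNReal.ofReal (Real.exp (-b * z)) * f z := by
  have hf' := hf.measurable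
  have hshift := (measurePreserving_add_right volume h).setLIntegral_comp_preimage
    (measurableSet_Ioo (a := x + h) (b := y + h))
    (f := fun z => ENNReal.ofReal (Real.exp (-b * z)) * f z) (by fun_prop)
  rw [← hshift, preimage_add_const_Ioo, add_sub_cancel_right, add_sub_cancel_right,
    ← lintegral_const_mul _ (by fun_prop)]
  refine lintegral_mono fun z => ?_
  rw [← mul_assoc, ← ENNReal.ofReal_mul (Real.exp_pos _).le, ← Real.exp_add,
    show b * h + -b * (z + h) = -b * z by ring]
  gcongr
  exact hf (by linarith)

theorem monotoneOn_of_tendsto_laplaceTransform [l.NeBot] (hfs : ∀ i, Monotone (fs i))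
    (hf : Measurable f) (hbs : ∀ i, laplaceTransform (fs i) b ≠ ⊤) (hb : laplaceTransform f b ≠ ⊤)
    (h : ∀ j : ℕ, Tendsto (fun i => laplaceTransform (fs i) (b + j)) l
      (𝓝 (laplaceTransform f (b + j))))
    (hcont : ∀ x, 0 < x → ContinuousWithinAt f (Ioi x) x) : MonotoneOn f (Ioi 0) := by
  intro x (hx : 0 < x) y (hy : 0 < y) hxy
  have hlim {u v : ℝ} (hu : 0 ≤ u) (huv : u < v) :=
    tendsto_setLIntegral_Ioo_of_tendsto_laplaceTransform (fun i => (hfs i).measurable) hf hbs hb h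
      hu huv
  have hincr {r : ℝ} (hr : 0 < r) :
      ∫⁻ z in Ioo x (x + r), ENNReal.ofReal (Real.exp (-b * z)) * f z ≤
        ENNReal.ofReal (Real.exp (b * (y - x))) *
          ∫⁻ z in Ioo y (y + r), ENNReal.ofReal (Real.exp (-b * z)) * f z := by
    refine le_of_tendsto_of_tendsto' (hlim hx.le (by linarith))
      (ENNReal.Tendsto.const_mul (hlim hy.le (by linarith)) (Or.inr ENNReal.ofReal_ne_top))
      fun i => ?_
    have := setLIntegral_Ioo_exp_mul_le_of_monotone (hfs i) b (sub_nonneg.2 hxy) x (x + r)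
    rwa [add_sub_cancel, add_right_comm, add_sub_cancel] at this
  have hweight : Continuous fun z => ENNReal.ofReal (Real.exp (-b * z)) :=
    ENNReal.continuous_ofReal.comp (by fun_prop)
  have havg {z : ℝ} (hz : 0 < z) : Tendsto (fun r =>
      (∫⁻ y in Ioo z (z + r), ENNReal.ofReal (Real.exp (-b * y)) * f y) / ENNReal.ofReal r)
      (𝓝[>] 0) (𝓝 (ENNReal.ofReal (Real.exp (-b * z)) * f z)) := by
    have hlim := tendsto_setLIntegral_Ioo_div (ENNReal.Tendsto.mul
      ((hweight.tendsto z).mono_left nhdsWithin_le_nhds) (Or.inl (by simp [Real.exp_pos]))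
      (hcont z hz) (Or.inr ENNReal.ofReal_ne_top))
    rw [← add_zero z, ← map_add_left_nhdsGT] at hlim
    simpa [Function.comp_def] using tendsto_map'_iff.1 hlim
  have hexp : ENNReal.ofReal (Real.exp (-b * x)) * f x ≤
      ENNReal.ofReal (Real.exp (b * (y - x))) * (ENNReal.ofReal (Real.exp (-b * y)) * f y) := by
    refine le_of_tendsto_of_tendsto (havg hx)
      (ENNReal.Tendsto.const_mul (havg hy) (Or.inr ENNReal.ofReal_ne_top)) ?_
    filter_upwards [self_mem_nhdsWithin] with r hr
    rw [← mul_div_assoc]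
    gcongr
    exact hincr hr
  rw [← mul_assoc, ← ENNReal.ofReal_mul (Real.exp_pos _).le, ← Real.exp_add,
    show b * (y - x) + -b * y = -b * x by ring] at hexp
  exact (ENNReal.mul_le_mul_iff_right (by simp [Real.exp_pos]) ENNReal.ofReal_ne_top).1 hexp

end LaplaceTransformLimits

section RenewalFunction

/-- The `n`-fold term `c (c k)^{⋆ n} ⋆ 1` of the Neumann series of the renewal equation
`u = c + c k ⋆ u` on `(0, ∞)`. -/
def renewalTerm (c : ℝ≥0∞) (k : ℝ → ℝ≥0∞) : ℕ → ℝ → ℝ≥0∞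
  | 0 => fun _ => c
  | n + 1 => fun x => c * (k ⋆₊ renewalTerm c k n) x

/-- The renewal function with constant `c` and kernel `k`: the solution of the renewal equation
`u = c + c k ⋆ u` on `(0, ∞)` given by its Neumann series. -/
def renewalFunction (c : ℝ≥0∞) (k : ℝ → ℝ≥0∞) (x : ℝ) : ℝ≥0∞ :=
  ∑' n, renewalTerm c k n x

variable {c : ℝ≥0∞} {k : ℝ → ℝ≥0∞} {b : ℝ}

theorem measurable_renewalTerm (c : ℝ≥0∞) (hk : Measurable k) (n : ℕ) :
    Measurable (renewalTerm c k n) := by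
  induction n with
  | zero => exact measurable_const
  | succ n ih => exact (measurable_halfLineConv hk ih).const_mul c

theorem renewalTerm_monotone (c : ℝ≥0∞) (k : ℝ → ℝ≥0∞) (n : ℕ) : Monotone (renewalTerm c k n) := by
  induction n with
  | zero => exact monotone_const
  | succ n ih => exact fun x y hxy => mul_le_mul_right (halfLineConv_monotone k ih hxy) c

theorem renewalFunction_monotone (c : ℝ≥0∞) (k : ℝ → ℝ≥0∞) : Monotone (renewalFunction c k) :=
  fun _ _ hxy => ENNReal.tsum_le_tsum fun n => renewalTerm_monotone c k n hxy

theorem laplaceTransform_renewalTerm (c : ℝ≥0∞) (hk : Measurable k) (hb : 0 < b) (n : ℕ) :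
    laplaceTransform (renewalTerm c k n) b =
      c * ENNReal.ofReal (1 / b) * (c * laplaceTransform k b) ^ n := by
  induction n with
  | zero => simpa [renewalTerm] using laplaceTransform_const hb c
  | succ n ih =>
    have hn := measurable_renewalTerm c hk n
    calc laplaceTransform (renewalTerm c k (n + 1)) b
        = c * (laplaceTransform k b * laplaceTransform (renewalTerm c k n) b) := by
          rw [← laplaceTransform_halfLineConv hk hn, ← laplaceTransform_const_mul (by fun_prop)]
          rfl
      _ = c * ENNReal.ofReal (1 / b) * (c * laplaceTransform k b) ^ (n + 1) := by
          rw [ih]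
          ring

theorem laplaceTransform_renewalFunction (c : ℝ≥0∞) (hk : Measurable k) (hb : 0 < b) :
    laplaceTransform (renewalFunction c k) b =
      c * ENNReal.ofReal (1 / b) * (1 - c * laplaceTransform k b)⁻¹ := by
  change laplaceTransform (fun x => ∑' n, renewalTerm c k n x) b = _
  rw [laplaceTransform_tsum (measurable_renewalTerm c hk)]
  simp only [laplaceTransform_renewalTerm c hk hb]
  rw [ENNReal.tsum_mul_left, ENNReal.tsum_geometric]

theorem laplaceTransform_renewalFunction_ofReal {δ κ : ℝ} (hk : Measurable k) (hb : 0 < b)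
    (hκ : 0 ≤ κ) (hκδ : κ < δ) (hkb : laplaceTransform k b = ENNReal.ofReal κ) :
    laplaceTransform (renewalFunction (ENNReal.ofReal δ⁻¹) k) b =
      ENNReal.ofReal (1 / (b * (δ - κ))) := by
  have hδ : 0 < δ := hκ.trans_lt hκδ
  have hpos : 0 < 1 - δ⁻¹ * κ := by
    rw [sub_pos, inv_mul_lt_iff₀ hδ, mul_one]
    exact hκδ
  rw [laplaceTransform_renewalFunction _ hk hb, hkb, ← ENNReal.ofReal_mul (by positivity),
    ← ENNReal.ofReal_mul (by positivity), ← ENNReal.ofReal_one,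
    ← ENNReal.ofReal_sub _ (by positivity), ← ENNReal.ofReal_inv_of_pos hpos,
    ← ENNReal.ofReal_mul (by positivity)]
  have : δ - κ ≠ 0 := (sub_pos.2 hκδ).ne'
  congr 1
  field_simp

end RenewalFunction

section RenewalEquation

variable {a : ℝ≥0∞} {w f l r : ℝ → ℝ≥0∞} {b : ℝ}

theorem eventually_add_halfLineConv_eq_of_laplaceTransform_eq (ha : a ≠ ⊤)
    (hw : Measurable w) (hw0 : w 0 ≠ ⊤) (hwc : ∀ x, 0 ≤ x → ContinuousWithinAt w (Ioi x) x)
    (hwb : laplaceTransform w b ≠ ⊤) (hf : Continuous f)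
    (hl : Measurable l) (hlb : laplaceTransform l b ≠ ⊤)
    (hr : Measurable r) (hrb : laplaceTransform r b ≠ ⊤)
    (h : ∀ j : ℕ, (a + laplaceTransform l (b + j)) * laplaceTransform w (b + j) =
      laplaceTransform f (b + j) + laplaceTransform r (b + j) * laplaceTransform w (b + j)) :
    ∀ᶠ x in 𝓝[>] 0, a * w x + (l ⋆₊ w) x = f x + (r ⋆₊ w) x := by
  have hleft (t : ℝ) : laplaceTransform (fun x => a * w x + (l ⋆₊ w) x) t =
      (a + laplaceTransform l t) * laplaceTransform w t := by
    rw [laplaceTransform_add (by fun_prop), laplaceTransform_const_mul hw,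
      laplaceTransform_halfLineConv hl hw, add_mul]
  have hright (t : ℝ) : laplaceTransform (fun x => f x + (r ⋆₊ w) x) t =
      laplaceTransform f t + laplaceTransform r t * laplaceTransform w t := by
    rw [laplaceTransform_add hf.measurable, laplaceTransform_halfLineConv hr hw]
  have hae := ae_eq_of_laplaceTransform_eq (f := fun x => a * w x + (l ⋆₊ w) x)
    (g := fun x => f x + (r ⋆₊ w) x) (b := b) (by fun_prop)
    (hf.measurable.add (by fun_prop)) (hleft b ▸ by finiteness)
    fun j => (hleft _).trans ((h j).trans (hright _).symm)
  obtain ⟨C, hwC, hC⟩ := exists_between hw0.lt_top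
  obtain ⟨u, hu, hwu⟩ :=
    mem_nhdsGT_iff_exists_Ioo_subset.1 ((hwc 0 le_rfl).eventually_lt_const hwC)
  have hconv {k : ℝ → ℝ≥0∞} (hk : Measurable k) (hkb : laplaceTransform k b ≠ ⊤) {x : ℝ}
      (hx : x ∈ Ioo 0 u) : ContinuousWithinAt (k ⋆₊ w) (Ioi x) x :=
    continuousWithinAt_halfLineConv hk
      (setLIntegral_Ioo_ne_top_of_laplaceTransform_ne_top hkb u) hw hC.ne
      (fun y hy => (hwu hy).le) (fun y hy => hwc y hy.1.le) hx
  refine mem_of_superset (Ioo_mem_nhdsGT hu) fun x hx =>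
    eqOn_of_ae_eq_of_continuousWithinAt_Ioi
      (ae_restrict_of_ae_restrict_of_subset Ioo_subset_Ioi_self hae) (fun y hy => ?_)
      (fun y hy => hf.continuousWithinAt.add (hconv hr hrb hy)) hx
  exact (ENNReal.Tendsto.const_mul (hwc y hy.1.le) (Or.inr ha)).add (hconv hl hlb hy)

end RenewalEquation

section RenewalAsymptotics

variable {k l r w : ℝ → ℝ≥0∞} {c d κ ρ : ℝ≥0∞}

theorem tendsto_div_ofReal_self :
    Tendsto (fun x => ENNReal.ofReal x / ENNReal.ofReal x) (𝓝[>] 0) (𝓝 1) := by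
  refine tendsto_const_nhds.congr' ?_
  filter_upwards [self_mem_nhdsWithin] with x hx
  exact (ENNReal.div_self (ENNReal.ofReal_pos.2 hx).ne' ENNReal.ofReal_ne_top).symm

theorem eq_zero_of_tendsto_div (hw : Tendsto w (𝓝[>] 0) (𝓝 c)) (hd : d ≠ ⊤)
    (h : Tendsto (fun x => w x / ENNReal.ofReal x) (𝓝[>] 0) (𝓝 d)) : c = 0 := by
  have hx : Tendsto ENNReal.ofReal (𝓝[>] 0) (𝓝 0) :=
    tendsto_nhdsWithin_of_tendsto_nhds (ENNReal.continuous_ofReal.tendsto' 0 0 ENNReal.ofReal_zero)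
  have hmul := ENNReal.Tendsto.mul h (Or.inr ENNReal.zero_ne_top) hx (Or.inr hd)
  rw [mul_zero] at hmul
  refine tendsto_nhds_unique (hw.congr' ?_) hmul
  filter_upwards [self_mem_nhdsWithin] with x hx0
  exact (ENNReal.div_mul_cancel (ENNReal.ofReal_pos.2 hx0).ne' ENNReal.ofReal_ne_top).symm

theorem tendsto_halfLineConv_nhdsGT_zero (hk : Measurable k)
    (hk0 : Tendsto (fun x => ∫⁻ y in Ioo 0 x, k y) (𝓝[>] 0) (𝓝 0))
    (hw : Tendsto w (𝓝[>] 0) (𝓝 c)) (hc : c ≠ ⊤) : Tendsto (k ⋆₊ w) (𝓝[>] 0) (𝓝 0) := by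
  have hbound := ENNReal.Tendsto.mul hk0 (Or.inr hc) (tendsto_biSup_Ioo_nhdsGT hw)
    (Or.inr ENNReal.zero_ne_top)
  rw [zero_mul] at hbound
  exact tendsto_of_tendsto_of_tendsto_of_le_of_le tendsto_const_nhds hbound
    (fun _ => zero_le) fun x => halfLineConv_le_mul hk fun y hy => le_biSup w hy

theorem tendsto_halfLineConv_div (hk : Measurable k) (hkκ : Tendsto k (𝓝[>] 0) (𝓝 κ))
    (hw : Tendsto w (𝓝[>] 0) (𝓝 c)) (hκc : κ ≠ 0 ∨ c ≠ ⊤) (hcκ : c ≠ 0 ∨ κ ≠ ⊤) :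
    Tendsto (fun x => (k ⋆₊ w) x / ENNReal.ofReal x) (𝓝[>] 0) (𝓝 (κ * c)) := by
  have havg := tendsto_setLIntegral_Ioo_div hkκ
  simp only [sub_zero] at havg
  refine tendsto_of_tendsto_of_tendsto_of_le_of_le
    (ENNReal.Tendsto.mul havg hκc (tendsto_biInf_Ioo_nhdsGT hw) hcκ)
    (ENNReal.Tendsto.mul havg hκc (tendsto_biSup_Ioo_nhdsGT hw) hcκ) (fun x => ?_) fun x => ?_
  all_goals
    simp only [ENNReal.div_eq_inv_mul, mul_assoc]
    gcongr
  exacts [mul_le_halfLineConv hk fun y hy => biInf_le w hy,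
    halfLineConv_le_mul hk fun y hy => le_biSup w hy]

theorem eq_inv_of_mul_eq_one_add_halfLineConv (hd : d ≠ ⊤) (hk : Measurable k)
    (hk0 : Tendsto (fun x => ∫⁻ y in Ioo 0 x, k y) (𝓝[>] 0) (𝓝 0))
    (hw : Tendsto w (𝓝[>] 0) (𝓝 c)) (hc : c ≠ ⊤)
    (h : ∀ᶠ x in 𝓝[>] 0, d * w x = 1 + (k ⋆₊ w) x) : c = d⁻¹ := by
  have hright : Tendsto (fun x => d * w x) (𝓝[>] 0) (𝓝 (1 + 0)) :=
    ((tendsto_halfLineConv_nhdsGT_zero hk hk0 hw hc).const_add 1).congr'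
      (h.mono fun x hx => hx.symm)
  refine ENNReal.eq_inv_of_mul_eq_one_left ?_
  rw [mul_comm, ← add_zero 1]
  exact tendsto_nhds_unique (ENNReal.Tendsto.const_mul hw (Or.inr hd)) hright

theorem sub_eq_of_mul_eq_one_add {a y : ℝ≥0∞} (hd0 : d ≠ 0) (hd : d ≠ ⊤) (h : d * a = 1 + y) :
    a - d⁻¹ = d⁻¹ * y := by
  rw [← ENNReal.inv_mul_cancel_left hd0 hd (b := a), h, mul_add, mul_one,
    ENNReal.add_sub_cancel_left (ENNReal.inv_ne_top.2 hd0)]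

theorem tendsto_sub_div_of_mul_eq_one_add_halfLineConv (hd0 : d ≠ 0) (hd : d ≠ ⊤)
    (hk : Measurable k) (hkκ : Tendsto k (𝓝[>] 0) (𝓝 κ)) (hw : Tendsto w (𝓝[>] 0) (𝓝 d⁻¹))
    (h : ∀ᶠ x in 𝓝[>] 0, d * w x = 1 + (k ⋆₊ w) x) :
    Tendsto (fun x => (w x - d⁻¹) / ENNReal.ofReal x) (𝓝[>] 0) (𝓝 (κ / d ^ 2)) := by
  have hinv : d⁻¹ ≠ ⊤ := ENNReal.inv_ne_top.2 hd0
  have hlim : Tendsto (fun x => d⁻¹ * ((k ⋆₊ w) x / ENNReal.ofReal x)) (𝓝[>] 0)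
      (𝓝 (d⁻¹ * (κ * d⁻¹))) :=
    ENNReal.Tendsto.const_mul (tendsto_halfLineConv_div hk hkκ hw (Or.inr hinv)
      (Or.inl (ENNReal.inv_ne_zero.2 hd))) (Or.inr hinv)
  have hvalue : d⁻¹ * (κ * d⁻¹) = κ / d ^ 2 := by
    rw [div_eq_mul_inv, ENNReal.inv_pow]
    ring
  rw [← hvalue]
  refine hlim.congr' (h.mono fun x hx => ?_)
  beta_reduce
  rw [sub_eq_of_mul_eq_one_add hd0 hd hx, mul_div_assoc]

theorem eventually_half_mul_biSup_le (hd0 : d ≠ 0) (hd : d ≠ ⊤) (hr : Measurable r)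
    (hr0 : Tendsto (fun x => ∫⁻ y in Ioo 0 x, r y) (𝓝[>] 0) (𝓝 0))
    (hw : Tendsto w (𝓝[>] 0) (𝓝 c)) (hc : c ≠ ⊤)
    (h : ∀ᶠ x in 𝓝[>] 0, d * w x ≤ ENNReal.ofReal x + (r ⋆₊ w) x) :
    ∀ᶠ x in 𝓝[>] 0, d / 2 * ⨆ y ∈ Ioo 0 x, w y ≤ ENNReal.ofReal x := by
  obtain ⟨u, hu, hsub⟩ := mem_nhdsGT_iff_exists_Ioo_subset.1 h
  filter_upwards [Ioo_mem_nhdsGT hu, hr0.eventually_lt_const (ENNReal.half_pos hd0),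
    (tendsto_biSup_Ioo_nhdsGT hw).eventually_lt_const hc.lt_top] with x hx hrx hwx
  set A := ⨆ y ∈ Ioo 0 x, w y
  have hdA : d * A ≤ ENNReal.ofReal x + d / 2 * A := by
    rw [show d * A = ⨆ y ∈ Ioo 0 x, d * w y by simp only [A, ENNReal.mul_iSup]]
    refine iSup₂_le fun y hy => (hsub ⟨hy.1, hy.2.trans hx.2⟩).trans ?_
    have hconv : (r ⋆₊ w) y ≤ (∫⁻ z in Ioo 0 y, r z) * A :=
      halfLineConv_le_mul hr fun z hz => le_biSup w ⟨hz.1, hz.2.trans hy.2⟩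
    have hmass : ∫⁻ z in Ioo 0 y, r z ≤ d / 2 :=
      (lintegral_mono_set (Ioo_subset_Ioo_right hy.2.le)).trans hrx.le
    exact add_le_add (ENNReal.ofReal_le_ofReal hy.2.le) (hconv.trans (mul_le_mul_left hmass A))
  rw [← ENNReal.add_halves d, add_mul, ENNReal.add_halves] at hdA
  exact (ENNReal.add_le_add_iff_right
    (ENNReal.mul_ne_top (ENNReal.div_ne_top hd two_ne_zero) hwx.ne)).1 hdA

theorem tendsto_halfLineConv_div_of_biSup_le {a : ℝ≥0∞} (ha : a ≠ 0) (hk : Measurable k)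
    (hk0 : Tendsto (fun x => ∫⁻ y in Ioo 0 x, k y) (𝓝[>] 0) (𝓝 0))
    (h : ∀ᶠ x in 𝓝[>] 0, a * ⨆ y ∈ Ioo 0 x, w y ≤ ENNReal.ofReal x) :
    Tendsto (fun x => (k ⋆₊ w) x / ENNReal.ofReal x) (𝓝[>] 0) (𝓝 0) := by
  have hbound := ENNReal.Tendsto.mul_const hk0 (Or.inr (ENNReal.inv_ne_top.2 ha))
  rw [zero_mul] at hbound
  refine tendsto_of_tendsto_of_tendsto_of_le_of_le' tendsto_const_nhds hbound
    (Eventually.of_forall fun _ => zero_le) ?_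
  filter_upwards [h] with x hx
  have hsup : ⨆ y ∈ Ioo 0 x, w y ≤ a⁻¹ * ENNReal.ofReal x := by
    rw [← ENNReal.div_eq_inv_mul,
      ENNReal.le_div_iff_mul_le (Or.inl ha) (Or.inr ENNReal.ofReal_ne_top), mul_comm]
    exact hx
  refine ENNReal.div_le_of_le_mul ((halfLineConv_le_mul hk fun y hy => le_biSup w hy).trans ?_)
  rw [mul_assoc]
  gcongr

theorem tendsto_div_of_mul_add_halfLineConv_eq (hd0 : d ≠ 0) (hd : d ≠ ⊤) (hl : Measurable l)
    (hl0 : Tendsto (fun x => ∫⁻ y in Ioo 0 x, l y) (𝓝[>] 0) (𝓝 0)) (hr : Measurable r)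
    (hr0 : Tendsto (fun x => ∫⁻ y in Ioo 0 x, r y) (𝓝[>] 0) (𝓝 0))
    (hw : Tendsto w (𝓝[>] 0) (𝓝 c)) (hc : c ≠ ⊤)
    (h : ∀ᶠ x in 𝓝[>] 0, d * w x + (l ⋆₊ w) x = ENNReal.ofReal x + (r ⋆₊ w) x) :
    Tendsto (fun x => w x / ENNReal.ofReal x) (𝓝[>] 0) (𝓝 d⁻¹) := by
  have hsup := eventually_half_mul_biSup_le hd0 hd hr hr0 hw hc
    (h.mono fun x hx => le_self_add.trans_eq hx)
  have hhalf := (ENNReal.half_pos hd0).ne'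
  have hldiv := tendsto_halfLineConv_div_of_biSup_le hhalf hl hl0 hsup
  have hrdiv := tendsto_halfLineConv_div_of_biSup_le hhalf hr hr0 hsup
  have hlfin : ∀ᶠ x in 𝓝[>] 0, (l ⋆₊ w) x < ⊤ :=
    (tendsto_halfLineConv_nhdsGT_zero hl hl0 hw hc).eventually_lt_const ENNReal.zero_lt_top
  have hlim : Tendsto (fun x => d⁻¹ * (ENNReal.ofReal x / ENNReal.ofReal x +
      (r ⋆₊ w) x / ENNReal.ofReal x - (l ⋆₊ w) x / ENNReal.ofReal x)) (𝓝[>] 0)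
      (𝓝 (d⁻¹ * (1 + 0 - 0))) :=
    ENNReal.Tendsto.const_mul (ENNReal.Tendsto.sub (tendsto_div_ofReal_self.add hrdiv) hldiv
      (Or.inr ENNReal.zero_ne_top)) (Or.inr (ENNReal.inv_ne_top.2 hd0))
  rw [add_zero, tsub_zero, mul_one] at hlim
  refine hlim.congr' ?_
  filter_upwards [h, hlfin, self_mem_nhdsWithin] with x hx hlx hx0
  have hx0' : ENNReal.ofReal x ≠ 0 := (ENNReal.ofReal_pos.2 hx0).ne'
  rw [← ENNReal.add_div, ← hx, ENNReal.add_div,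
    ENNReal.add_sub_cancel_right (ENNReal.div_ne_top hlx.ne hx0'), mul_div_assoc,
    ENNReal.inv_mul_cancel_left hd0 hd]

theorem eq_zero_of_halfLineConv_eq (hl : Measurable l) (hl_top : Tendsto l (𝓝[>] 0) (𝓝 ⊤))
    (hr : Measurable r) (hrρ : Tendsto r (𝓝[>] 0) (𝓝 ρ)) (hρ : ρ ≠ ⊤)
    (hw : Tendsto w (𝓝[>] 0) (𝓝 c)) (hc : c ≠ ⊤)
    (h : ∀ᶠ x in 𝓝[>] 0, (l ⋆₊ w) x = ENNReal.ofReal x + (r ⋆₊ w) x) : c = 0 := by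
  by_contra hc0
  have hleft := tendsto_halfLineConv_div hl hl_top hw (Or.inl ENNReal.top_ne_zero) (Or.inl hc0)
  have hright := tendsto_div_ofReal_self.add
    (tendsto_halfLineConv_div hr hrρ hw (Or.inr hc) (Or.inr hρ))
  refine (by finiteness : 1 + ρ * c ≠ ⊤) ((tendsto_nhds_unique (hleft.congr' ?_) hright).symm.trans
    (ENNReal.top_mul hc0))
  filter_upwards [h] with x hx
  rw [hx, ENNReal.add_div]

theorem tendsto_div_top_of_ofReal_le_halfLineConv (hl : Measurable l)
    (hl0 : Tendsto (fun x => ∫⁻ y in Ioo 0 x, l y) (𝓝[>] 0) (𝓝 0)) (hw : MonotoneOn w (Ioi 0))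
    (h : ∀ᶠ x in 𝓝[>] 0, ENNReal.ofReal x ≤ (l ⋆₊ w) x) :
    Tendsto (fun x => w x / ENNReal.ofReal x) (𝓝[>] 0) (𝓝 ⊤) := by
  have hinv : Tendsto (fun x => (∫⁻ y in Ioo 0 x, l y)⁻¹) (𝓝[>] 0) (𝓝 ⊤) := by
    simpa using tendsto_inv_iff.2 hl0
  refine tendsto_nhds_top_mono hinv ?_
  filter_upwards [h, self_mem_nhdsWithin] with x hx hx0
  have hle : ENNReal.ofReal x ≤ (∫⁻ y in Ioo 0 x, l y) * w x :=
    hx.trans (halfLineConv_le_mul hl fun y hy => hw hy.1 hx0 hy.2.le)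
  rw [ENNReal.le_div_iff_mul_le (Or.inl (ENNReal.ofReal_pos.2 hx0).ne')
    (Or.inl ENNReal.ofReal_ne_top), mul_comm, ← div_eq_mul_inv]
  exact ENNReal.div_le_of_le_mul' hle

end RenewalAsymptotics

section ToReal

variable {W : ℝ → ℝ} {a D : ℝ}

theorem eventually_ofReal_sub_div_ofReal (ha : 0 ≤ a) :
    ∀ᶠ x in 𝓝[>] 0, (ENNReal.ofReal (W x) - ENNReal.ofReal a) / ENNReal.ofReal x =
      ENNReal.ofReal ((W x - a) / x) := by
  filter_upwards [self_mem_nhdsWithin] with x hx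
  rw [← ENNReal.ofReal_sub _ ha, ENNReal.ofReal_div_of_pos hx]

theorem tendsto_div_of_tendsto_ofReal_sub_div (ha : 0 ≤ a) (hD : 0 ≤ D)
    (hW : ∀ᶠ x in 𝓝[>] 0, a ≤ W x)
    (h : Tendsto (fun x => (ENNReal.ofReal (W x) - ENNReal.ofReal a) / ENNReal.ofReal x)
      (𝓝[>] 0) (𝓝 (ENNReal.ofReal D))) :
    Tendsto (fun x => (W x - a) / x) (𝓝[>] 0) (𝓝 D) := by
  have hreal := (ENNReal.tendsto_toReal ENNReal.ofReal_ne_top).comp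
    (h.congr' (eventually_ofReal_sub_div_ofReal ha))
  rw [ENNReal.toReal_ofReal hD] at hreal
  refine hreal.congr' ?_
  filter_upwards [hW, self_mem_nhdsWithin] with x hx hx0
  exact ENNReal.toReal_ofReal (div_nonneg (sub_nonneg.2 hx) (le_of_lt hx0))

theorem tendsto_div_atTop_of_tendsto_ofReal_sub_div (ha : 0 ≤ a)
    (h : Tendsto (fun x => (ENNReal.ofReal (W x) - ENNReal.ofReal a) / ENNReal.ofReal x)
      (𝓝[>] 0) (𝓝 ⊤)) : Tendsto (fun x => (W x - a) / x) (𝓝[>] 0) atTop :=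
  ENNReal.tendsto_ofReal_nhds_top.1 (h.congr' (eventually_ofReal_sub_div_ofReal ha))

end ToReal

section LevyMeasure

/-- The Lévy measures carried by `(-∞, 0)`: those which integrate `1 ∧ x²`. -/
class IsNegLevyMeasure (P : Measure ℝ) : Prop where
  measure_Ici : P (Ici 0) = 0
  lintegral_lt_top : ∫⁻ x, ENNReal.ofReal (min 1 (x ^ 2)) ∂P < ⊤

/-- The variation `∫_{(-1, 0)} |x| Π(dx)` of the small jumps, per unit of time. -/
def smallJumpVariation (P : Measure ℝ) : ℝ≥0∞ := ∫⁻ x in Ioo (-1) 0, ENNReal.ofReal |x| ∂P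

/-- The compensated integrand `e^{b x} - 1 - b x 𝟙_{|x| < 1}` of the Laplace exponent. -/
def levyIntegrand (b x : ℝ) : ℝ :=
  Real.exp (b * x) - 1 - b * x * indicator {y : ℝ | |y| < 1} 1 x

/-- The contribution of the jumps to the Laplace exponent. -/
def jumpExponent (P : Measure ℝ) (b : ℝ) : ℝ := ∫ x in Iio 0, levyIntegrand b x ∂P

variable {P : Measure ℝ} {b : ℝ}

instance IsNegLevyMeasure.sFinite [h : IsNegLevyMeasure P] : SFinite P := by
  have hf : Measurable fun x : ℝ => ENNReal.ofReal (min 1 (x ^ 2)) := by fun_prop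
  have hne : ∀ᵐ x ∂P, ENNReal.ofReal (min 1 (x ^ 2)) ≠ 0 := by
    filter_upwards [measure_eq_zero_iff_ae_notMem.1 h.measure_Ici] with x hx
    have := sq_pos_of_neg (not_le.1 (mem_Ici.not.1 hx))
    exact (ENNReal.ofReal_pos.2 (by positivity)).ne'
  have := isFiniteMeasure_withDensity h.lintegral_lt_top.ne
  rw [← withDensity_inv_same hf hne (ae_of_all _ fun x => ENNReal.ofReal_ne_top)]
  infer_instance

instance IsNegLevyMeasure.restrict [h : IsNegLevyMeasure P] (s : Set ℝ) :
    IsNegLevyMeasure (P.restrict s) where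
  measure_Ici := nonpos_iff_eq_zero.1 ((Measure.restrict_apply_le _ _).trans_eq h.measure_Ici)
  lintegral_lt_top := (setLIntegral_le_lintegral _ _).trans_lt h.lintegral_lt_top

theorem integrable_min_one_sq [h : IsNegLevyMeasure P] :
    Integrable (fun x => min 1 (x ^ 2)) P :=
  ⟨by fun_prop, (hasFiniteIntegral_iff_ofReal (ae_of_all _ fun x => by positivity)).2
    h.lintegral_lt_top⟩

theorem measure_Iic_lt_top_of_neg [h : IsNegLevyMeasure P] {x : ℝ} (hx : x < 0) :
    P (Iic x) < ⊤ := by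
  have hpos : 0 < min 1 (x ^ 2) := by have := sq_pos_of_neg hx; positivity
  refine (measure_mono fun y (hy : y ≤ x) => ?_).trans_lt
    (integrable_min_one_sq.measure_ge_lt_top hpos)
  exact min_le_min_left 1 (show x ^ 2 ≤ y ^ 2 by nlinarith)

theorem smallJumpVariation_ne_top_of_measure_Iio_lt_top (h : P (Iio 0) < ⊤) :
    smallJumpVariation P ≠ ⊤ := by
  refine ((setLIntegral_mono' measurableSet_Ioo (g := 1) fun x hx => ?_).trans_lt ?_).ne
  · exact ENNReal.ofReal_le_one.2 (abs_le.2 ⟨hx.1.le, hx.2.le.trans zero_le_one⟩)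
  · exact lintegral_one.trans_lt <| (Measure.restrict_apply_univ _).trans_lt <|
      (measure_mono Ioo_subset_Iio_self).trans_lt h

theorem integrableOn_id_of_smallJumpVariation_ne_top (h : smallJumpVariation P ≠ ⊤) :
    IntegrableOn (fun x => x) (Ioo (-1) 0) P :=
  ⟨by fun_prop, (hasFiniteIntegral_iff_norm _).2 h.lt_top⟩

theorem exp_sub_one_sub_nonneg (y : ℝ) : 0 ≤ Real.exp y - 1 - y := by
  linarith [Real.add_one_le_exp y]

theorem exp_sub_one_sub_le_sq {y : ℝ} (hy : y ≤ 0) : Real.exp y - 1 - y ≤ y ^ 2 := by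
  rcases le_total (-1) y with h | h
  · exact (le_abs_self _).trans
      (Real.abs_exp_sub_one_sub_id_le (abs_le.2 ⟨h, hy.trans zero_le_one⟩))
  · nlinarith [Real.exp_le_one_iff.2 hy]

theorem one_sub_exp_mul_nonneg {x : ℝ} (hb : 0 ≤ b) (hx : x ≤ 0) : 0 ≤ 1 - Real.exp (b * x) :=
  sub_nonneg.2 (Real.exp_le_one_iff.2 (mul_nonpos_of_nonneg_of_nonpos hb hx))

theorem levyIntegrand_of_mem_Ioo {x : ℝ} (hx : x ∈ Ioo (-1) 0) :
    levyIntegrand b x = Real.exp (b * x) - 1 - b * x := by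
  have : |x| < 1 := abs_lt.2 ⟨hx.1, hx.2.trans one_pos⟩
  simp [levyIntegrand, this]

theorem levyIntegrand_of_mem_Iic {x : ℝ} (hx : x ∈ Iic (-1)) :
    levyIntegrand b x = -(1 - Real.exp (b * x)) := by
  have : ¬ |x| < 1 := not_lt.2 (le_abs.2 (Or.inr (le_neg.1 hx)))
  simp [levyIntegrand, this]

theorem disjoint_Iic_Ioo_neg_one : Disjoint (Iic (-1 : ℝ)) (Ioo (-1) 0) :=
  disjoint_left.2 fun _ hx hx' => not_lt.2 hx hx'.1

theorem Iic_union_Ioo_neg_one : Iic (-1 : ℝ) ∪ Ioo (-1) 0 = Iio 0 :=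
  Iic_union_Ioo_eq_Iio neg_one_lt_zero

theorem integrableOn_exp_sub_one_sub [IsNegLevyMeasure P] (hb : 0 ≤ b) :
    IntegrableOn (fun x => Real.exp (b * x) - 1 - b * x) (Ioo (-1) 0) P := by
  refine (integrable_min_one_sq.const_mul (b ^ 2)).integrableOn.mono' (by fun_prop) ?_
  filter_upwards [ae_restrict_mem measurableSet_Ioo] with x hx
  rw [Real.norm_of_nonneg (exp_sub_one_sub_nonneg _), min_eq_right (by nlinarith [hx.1, hx.2]),
    ← mul_pow]
  exact exp_sub_one_sub_le_sq (mul_nonpos_of_nonneg_of_nonpos hb hx.2.le)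

theorem integrableOn_Iic_one_sub_exp [IsNegLevyMeasure P] (hb : 0 ≤ b) :
    IntegrableOn (fun x => 1 - Real.exp (b * x)) (Iic (-1)) P := by
  refine integrable_min_one_sq.integrableOn.mono' (by fun_prop) ?_
  filter_upwards [ae_restrict_mem measurableSet_Iic] with x (hx : x ≤ -1)
  rw [Real.norm_of_nonneg (one_sub_exp_mul_nonneg hb (by linarith)), min_eq_left (by nlinarith)]
  linarith [Real.exp_pos (b * x)]

theorem integrableOn_Iio_one_sub_exp [IsNegLevyMeasure P] (hP : smallJumpVariation P ≠ ⊤)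
    (hb : 0 ≤ b) : IntegrableOn (fun x => 1 - Real.exp (b * x)) (Iio 0) P := by
  rw [← Iic_union_Ioo_neg_one]
  refine (integrableOn_Iic_one_sub_exp hb).union
    ((((integrableOn_id_of_smallJumpVariation_ne_top hP).const_mul b).add
      (integrableOn_exp_sub_one_sub hb)).neg.congr (ae_of_all _ fun x => ?_))
  simp only [Pi.add_apply, Pi.neg_apply]
  ring

theorem integrableOn_levyIntegrand [IsNegLevyMeasure P] (hb : 0 ≤ b) :
    IntegrableOn (levyIntegrand b) (Iio 0) P := by
  rw [← Iic_union_Ioo_neg_one]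
  exact ((integrableOn_Iic_one_sub_exp hb).neg.congr_fun
      (fun x hx => (levyIntegrand_of_mem_Iic hx).symm) measurableSet_Iic).union
    ((integrableOn_exp_sub_one_sub hb).congr_fun
      (fun x hx => (levyIntegrand_of_mem_Ioo hx).symm) measurableSet_Ioo)

theorem jumpExponent_eq_sub [IsNegLevyMeasure P] (hb : 0 ≤ b) :
    jumpExponent P b = ∫ x in Ioo (-1) 0, (Real.exp (b * x) - 1 - b * x) ∂P
      - ∫ x in Iic (-1), (1 - Real.exp (b * x)) ∂P := by
  have hint := integrableOn_levyIntegrand (P := P) hb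
  unfold jumpExponent
  rw [← Iic_union_Ioo_neg_one] at hint ⊢
  rw [setIntegral_union disjoint_Iic_Ioo_neg_one measurableSet_Ioo
    hint.left_of_union hint.right_of_union,
    setIntegral_congr_fun measurableSet_Iic fun x hx => levyIntegrand_of_mem_Iic hx,
    setIntegral_congr_fun measurableSet_Ioo fun x hx => levyIntegrand_of_mem_Ioo hx,
    integral_neg, neg_add_eq_sub]

theorem jumpExponent_eq_of_smallJumpVariation_ne_top [IsNegLevyMeasure P]
    (hP : smallJumpVariation P ≠ ⊤) (hb : 0 ≤ b) :
    jumpExponent P b =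
      -(b * ∫ x in Ioo (-1) 0, x ∂P) - ∫ x in Iio 0, (1 - Real.exp (b * x)) ∂P := by
  have hlarge := integrableOn_Iic_one_sub_exp (P := P) hb
  have hsmall := (integrableOn_Iio_one_sub_exp hP hb).mono_set (Ioo_subset_Iio_self (a := -1))
  have hid := (integrableOn_id_of_smallJumpVariation_ne_top hP).const_mul b
  have hsplit : ∫ x in Ioo (-1) 0, (Real.exp (b * x) - 1 - b * x) ∂P =
      -((b * ∫ x in Ioo (-1) 0, x ∂P) + ∫ x in Ioo (-1) 0, (1 - Real.exp (b * x)) ∂P) := by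
    rw [← integral_const_mul, ← integral_add hid hsmall, ← integral_neg]
    congr with x
    ring
  rw [jumpExponent_eq_sub hb, hsplit, ← Iic_union_Ioo_neg_one,
    setIntegral_union disjoint_Iic_Ioo_neg_one measurableSet_Ioo hlarge hsmall]
  ring

end LevyMeasure

section Truncation

/-- The Lévy measure `P` without the jumps of size at most `ε`. -/
def truncation (P : Measure ℝ) (ε : ℝ) : Measure ℝ := P.restrict (Iio (-ε))

variable {P : Measure ℝ} {b ε : ℝ}

instance [IsNegLevyMeasure P] : IsNegLevyMeasure (truncation P ε) := IsNegLevyMeasure.restrict _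

theorem tendsto_neg_nhdsGT_zero : Tendsto (fun ε : ℝ => -ε) (𝓝[>] 0) (𝓝 0) :=
  tendsto_nhdsWithin_of_tendsto_nhds (by simpa using (tendsto_id (x := 𝓝 (0 : ℝ))).neg)

theorem smallJumpVariation_truncation_ne_top [IsNegLevyMeasure P] (hε : 0 < ε) :
    smallJumpVariation (truncation P ε) ≠ ⊤ :=
  smallJumpVariation_ne_top_of_measure_Iio_lt_top <| (measure_mono (subset_univ _)).trans_lt <|
    (Measure.restrict_apply_univ _).trans_lt <| (measure_mono Iio_subset_Iic_self).trans_lt <|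
      measure_Iic_lt_top_of_neg (neg_neg_iff_pos.2 hε)

theorem tendsto_smallJumpVariation_truncation (P : Measure ℝ) :
    Tendsto (fun ε => smallJumpVariation (truncation P ε)) (𝓝[>] 0) (𝓝 (smallJumpVariation P)) := by
  have hcover : AECover (P.restrict (Ioo (-1) 0)) (𝓝[>] (0 : ℝ)) fun ε => Iio (-ε) := by
    have hsmall : (P.restrict (Ioo (-1) 0)).restrict (Iio 0) = P.restrict (Ioo (-1) 0) := by
      rw [Measure.restrict_restrict measurableSet_Iio, inter_eq_right.2 Ioo_subset_Iio_self]
    rw [← hsmall]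
    exact aecover_Iio_of_Iio tendsto_neg_nhdsGT_zero
  refine (hcover.lintegral_tendsto_of_countably_generated
    (f := fun x => ENNReal.ofReal |x|) (by fun_prop)).congr fun ε => ?_
  rw [smallJumpVariation, truncation, Measure.restrict_restrict measurableSet_Iio,
    Measure.restrict_restrict measurableSet_Ioo, inter_comm]

theorem tendsto_measure_Iio_neg (P : Measure ℝ) :
    Tendsto (fun ε => P (Iio (-ε))) (𝓝[>] 0) (𝓝 (P (Iio 0))) := by
  have hcover := (aecover_Iio_of_Iio (μ := P) tendsto_neg_nhdsGT_zero
    ).lintegral_tendsto_of_countably_generated (f := 1) aemeasurable_one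
  simp only [Pi.one_apply, lintegral_one, Measure.restrict_apply_univ] at hcover
  refine hcover.congr' ?_
  filter_upwards [self_mem_nhdsWithin] with ε (hε : 0 < ε)
  rw [Measure.restrict_apply measurableSet_Iio, Iio_inter_Iio, min_eq_left (neg_nonpos.2 hε.le)]

theorem jumpExponent_truncation (P : Measure ℝ) (hε : 0 ≤ ε) (b : ℝ) :
    jumpExponent (truncation P ε) b = ∫ x in Iio (-ε), levyIntegrand b x ∂P := by
  rw [jumpExponent, truncation, Measure.restrict_restrict measurableSet_Iio, Iio_inter_Iio,
    min_eq_right (neg_nonpos.2 hε)]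

theorem jumpExponent_truncation_zero (P : Measure ℝ) (b : ℝ) :
    jumpExponent (truncation P 0) b = jumpExponent P b := by
  rw [jumpExponent_truncation P le_rfl, neg_zero, jumpExponent]

theorem tendsto_jumpExponent_truncation [IsNegLevyMeasure P] (hb : 0 ≤ b) :
    Tendsto (fun ε => jumpExponent (truncation P ε) b) (𝓝[>] 0) (𝓝 (jumpExponent P b)) := by
  refine ((aecover_Iio_of_Iio tendsto_neg_nhdsGT_zero).integral_tendsto_of_countably_generated
    (integrableOn_levyIntegrand hb)).congr' ?_
  filter_upwards [self_mem_nhdsWithin] with ε (hε : 0 < ε)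
  rw [jumpExponent_truncation P hε.le, Measure.restrict_restrict measurableSet_Iio, Iio_inter_Iio,
    min_eq_left (neg_nonpos.2 hε.le)]

theorem antitoneOn_jumpExponent_truncation [IsNegLevyMeasure P] (hb : 0 ≤ b) :
    AntitoneOn (fun ε => jumpExponent (truncation P ε) b) (Ico 0 1) := by
  intro ε hε η hη hεη
  have hint := (integrableOn_levyIntegrand (P := P) hb).mono_set
    (Iio_subset_Iio (neg_nonpos.2 hε.1))
  have hdisj : Disjoint (Iio (-η)) (Ico (-η) (-ε)) :=
    disjoint_left.2 fun x hx hx' => not_lt.2 hx'.1 hx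
  beta_reduce
  rw [jumpExponent_truncation P hε.1, jumpExponent_truncation P hη.1]
  rw [← Iio_union_Ico_eq_Iio (neg_le_neg hεη)] at hint ⊢
  rw [setIntegral_union hdisj measurableSet_Ico hint.left_of_union hint.right_of_union]
  refine le_add_of_nonneg_right (setIntegral_nonneg measurableSet_Ico fun x hx => ?_)
  rw [levyIntegrand_of_mem_Ioo ⟨by linarith [hx.1, hη.2], by linarith [hx.2, hε.1]⟩]
  exact exp_sub_one_sub_nonneg _

theorem eventually_truncation_drift_pos [IsNegLevyMeasure P] (hP : smallJumpVariation P = ⊤)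
    (mu : ℝ) : ∀ᶠ ε in 𝓝[>] 0, 0 < -mu - ∫ x in Ioo (-1) 0, x ∂(truncation P ε) := by
  have hlim := tendsto_smallJumpVariation_truncation P
  rw [hP] at hlim
  filter_upwards [hlim.eventually_const_lt (ENNReal.ofReal_lt_top (r := mu)),
    self_mem_nhdsWithin] with ε hε hε0
  have hint := integrableOn_id_of_smallJumpVariation_ne_top
    (smallJumpVariation_truncation_ne_top (P := P) hε0)
  rw [smallJumpVariation, ← ofReal_integral_eq_lintegral_ofReal hint.abs
    (ae_of_all _ fun x => abs_nonneg x), setIntegral_congr_fun measurableSet_Ioo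
    fun x hx => abs_of_neg hx.2, integral_neg, ENNReal.ofReal_lt_ofReal_iff'] at hε
  linarith [hε.1]

end Truncation

section Kernels

/-- The tail `Π (-∞, -y) + q` of the jump measure of a process of bounded variation killed at
rate `q`: the kernel of the renewal equation for its scale function. -/
def killedTail (P : Measure ℝ) (q y : ℝ) : ℝ≥0∞ := P (Iio (-y)) + ENNReal.ofReal q

/-- The integrated tail `y ↦ ∫_{(-1, 0)} (-x - y)⁺ Π(dx)` of the small jumps, the truncation
`(·)⁺` being that of `ENNReal.ofReal`. -/
def integratedTail (P : Measure ℝ) (y : ℝ) : ℝ≥0∞ :=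
  ∫⁻ x in Ioo (-1) 0, ENNReal.ofReal (-x - y) ∂P

/-- The kernel collecting the terms of `(ψ(b) - q) / b²` which enter with a positive sign, namely
the small jumps and `μ⁻`. -/
def leftKernel (P : Measure ℝ) (mu y : ℝ) : ℝ≥0∞ := integratedTail P y + ENNReal.ofReal (-mu)

/-- The kernel collecting the terms of `(ψ(b) - q) / b²` which enter with a negative sign, namely
`μ⁺`, the large jumps and the killing. -/
def rightKernel (P : Measure ℝ) (mu q y : ℝ) : ℝ≥0∞ :=
  ENNReal.ofReal mu + ((fun _ => 1) ⋆₊ killedTail (P.restrict (Iic (-1))) q) y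

variable {P : Measure ℝ} {a b q mu : ℝ}

theorem antitone_measure_Iio_neg (P : Measure ℝ) : Antitone fun y => P (Iio (-y)) :=
  fun _ _ h => measure_mono (Iio_subset_Iio (neg_le_neg h))

@[fun_prop]
theorem measurable_killedTail (P : Measure ℝ) (q : ℝ) : Measurable (killedTail P q) :=
  (antitone_measure_Iio_neg P).measurable.add_const _

theorem integratedTail_antitone (P : Measure ℝ) : Antitone (integratedTail P) := fun _ _ h =>
  lintegral_mono fun _ => ENNReal.ofReal_le_ofReal (sub_le_sub_left h _)

@[fun_prop]
theorem measurable_integratedTail (P : Measure ℝ) : Measurable (integratedTail P) :=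
  (integratedTail_antitone P).measurable

@[fun_prop]
theorem measurable_leftKernel (P : Measure ℝ) (mu : ℝ) : Measurable (leftKernel P mu) :=
  (measurable_integratedTail P).add_const _

@[fun_prop]
theorem measurable_rightKernel (P : Measure ℝ) (mu q : ℝ) : Measurable (rightKernel P mu q) :=
  (measurable_halfLineConv measurable_const (measurable_killedTail _ q)).const_add _

theorem tendsto_killedTail (P : Measure ℝ) (q : ℝ) :
    Tendsto (killedTail P q) (𝓝[>] 0) (𝓝 (P (Iio 0) + ENNReal.ofReal q)) :=
  (tendsto_measure_Iio_neg P).add_const _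

theorem half_smallJumpVariation_truncation_le_integratedTail (P : Measure ℝ) (y : ℝ) :
    2⁻¹ * smallJumpVariation (truncation P (2 * y)) ≤ integratedTail P y := by
  rw [smallJumpVariation, truncation, Measure.restrict_restrict measurableSet_Ioo,
    ← lintegral_const_mul _ (by fun_prop)]
  refine (setLIntegral_mono' (measurableSet_Ioo.inter measurableSet_Iio) fun x hx => ?_).trans
    (lintegral_mono_set inter_subset_left)
  have hxy : x < -(2 * y) := hx.2
  rw [abs_of_neg hx.1.2, ← ENNReal.ofReal_ofNat, ← ENNReal.ofReal_inv_of_pos two_pos,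
    ← ENNReal.ofReal_mul (by positivity)]
  exact ENNReal.ofReal_le_ofReal (by linarith)

theorem tendsto_leftKernel_top (hP : smallJumpVariation P = ⊤) (mu : ℝ) :
    Tendsto (leftKernel P mu) (𝓝[>] 0) (𝓝 ⊤) := by
  have hdouble : Tendsto (fun y : ℝ => 2 * y) (𝓝[>] 0) (𝓝[>] 0) := by
    refine tendsto_nhdsWithin_iff.2 ⟨tendsto_nhdsWithin_of_tendsto_nhds ?_, ?_⟩
    · simpa using (tendsto_id (x := 𝓝 (0 : ℝ))).const_mul 2
    · filter_upwards [self_mem_nhdsWithin] with y (hy : 0 < y) using mul_pos two_pos hy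
  have hlim := ENNReal.Tendsto.const_mul (a := 2⁻¹)
    ((tendsto_smallJumpVariation_truncation P).comp hdouble) (Or.inr (by simp))
  rw [hP, ENNReal.mul_top (by simp)] at hlim
  exact tendsto_nhds_top_mono hlim (Eventually.of_forall fun y =>
    (half_smallJumpVariation_truncation_le_integratedTail P y).trans le_self_add)

theorem setLIntegral_Ioo_ofReal_eq_sub {F f : ℝ → ℝ} {s t : ℝ} (hst : s ≤ t)
    (hF : ∀ x, HasDerivAt F (f x) x) (hf : Continuous f) (hf0 : ∀ x ∈ Ioo s t, 0 ≤ f x) :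
    ∫⁻ x in Ioo s t, ENNReal.ofReal (f x) = ENNReal.ofReal (F t - F s) := by
  rw [← intervalIntegral.integral_eq_sub_of_hasDerivAt (fun x _ => hF x)
    (hf.intervalIntegrable s t), intervalIntegral.integral_of_le hst,
    ← integral_Ioc_eq_integral_Ioo.symm, ofReal_integral_eq_lintegral_ofReal
    (hf.integrableOn_Icc.mono_set Ioo_subset_Icc_self)
    ((ae_restrict_iff' measurableSet_Ioo).2 (ae_of_all _ hf0))]

theorem laplaceTransform_indicator_Iio (ha : 0 ≤ a) (hb : 0 < b) :
    laplaceTransform ((Iio a).indicator 1) b = ENNReal.ofReal ((1 - Real.exp (-b * a)) / b) := by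
  have hderiv (y : ℝ) : HasDerivAt (fun y => -Real.exp (-b * y) / b) (Real.exp (-b * y)) y := by
    refine (((hasDerivAt_id y).const_mul (-b)).exp.neg.div_const b).congr_deriv ?_
    simp only [id]
    field_simp
  calc laplaceTransform ((Iio a).indicator 1) b
      = ∫⁻ y in Ioo 0 a, ENNReal.ofReal (Real.exp (-b * y)) := by
        rw [← Iio_inter_Ioi, ← setLIntegral_indicator measurableSet_Iio]
        refine lintegral_congr fun y => ?_
        by_cases hy : y < a <;> simp [hy]
    _ = _ := by
        rw [setLIntegral_Ioo_ofReal_eq_sub ha hderiv (by fun_prop)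
          fun y _ => (Real.exp_pos _).le]
        congr 1
        simp only [mul_zero, Real.exp_zero]
        ring

theorem laplaceTransform_ofReal_sub (ha : 0 ≤ a) (hb : 0 < b) :
    laplaceTransform (fun y => ENNReal.ofReal (a - y)) b =
      ENNReal.ofReal ((Real.exp (-b * a) - 1 + b * a) / b ^ 2) := by
  have hderiv (y : ℝ) : HasDerivAt (fun y => Real.exp (-b * y) * (-(a - y) / b + 1 / b ^ 2))
      (Real.exp (-b * y) * (a - y)) y := by
    refine (((hasDerivAt_id y).const_mul (-b)).exp.mul
      ((((hasDerivAt_id y).const_sub a).neg.div_const b).add_const (1 / b ^ 2))).congr_deriv ?_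
    simp only [id, Pi.neg_apply]
    field_simp
    ring
  calc laplaceTransform (fun y => ENNReal.ofReal (a - y)) b
      = ∫⁻ y in Ioo 0 a, ENNReal.ofReal (Real.exp (-b * y) * (a - y)) := by
        rw [← Iio_inter_Ioi, ← setLIntegral_indicator measurableSet_Iio]
        refine lintegral_congr fun y => ?_
        by_cases hy : y < a
        · simp [hy, ENNReal.ofReal_mul (Real.exp_pos _).le]
        · simp [hy, ENNReal.ofReal_of_nonpos (sub_nonpos.2 (not_lt.1 hy))]
    _ = _ := by
        rw [setLIntegral_Ioo_ofReal_eq_sub ha hderiv (by fun_prop)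
          fun y hy => mul_nonneg (Real.exp_pos _).le (sub_nonneg.2 hy.2.le)]
        congr 1
        simp only [sub_self, neg_zero, zero_div, zero_add, mul_zero, Real.exp_zero, sub_zero]
        field_simp
        ring

theorem laplaceTransform_measure_Iio_neg [SFinite P] (hb : 0 < b)
    (hP : IntegrableOn (fun x => 1 - Real.exp (b * x)) (Iio 0) P) :
    laplaceTransform (fun y => P (Iio (-y))) b =
      ENNReal.ofReal ((∫ x in Iio 0, (1 - Real.exp (b * x)) ∂P) / b) := by
  have htail (y : ℝ) (hy : 0 < y) :
      P (Iio (-y)) = ∫⁻ x in Iio 0, (Iio (-x)).indicator 1 y ∂P := by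
    have hswap : (fun x => (Iio (-x)).indicator (1 : ℝ → ℝ≥0∞) y) = (Iio (-y)).indicator 1 := by
      ext x
      simp [indicator, lt_neg]
    rw [hswap, lintegral_indicator_one measurableSet_Iio, Measure.restrict_apply measurableSet_Iio,
      Iio_inter_Iio, min_eq_left (neg_nonpos.2 hy.le)]
  have hmeas : Measurable (Function.uncurry fun x y : ℝ => (Iio (-x)).indicator (1 : ℝ → ℝ≥0∞) y) :=
    (measurable_const (a := (1 : ℝ≥0∞))).indicator
      (measurableSet_lt measurable_snd measurable_fst.neg)
  rw [laplaceTransform_congr htail, laplaceTransform_lintegral hmeas, ← integral_div,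
    ofReal_integral_eq_lintegral_ofReal (hP.div_const b)]
  · refine setLIntegral_congr_fun measurableSet_Iio fun x (hx : x < 0) => ?_
    rw [laplaceTransform_indicator_Iio (neg_nonneg.2 hx.le) hb, neg_mul_neg]
  · filter_upwards [ae_restrict_mem measurableSet_Iio] with x hx
    exact div_nonneg (one_sub_exp_mul_nonneg hb.le (le_of_lt hx)) hb.le

theorem laplaceTransform_killedTail [SFinite P] (hq : 0 ≤ q) (hb : 0 < b)
    (hP : IntegrableOn (fun x => 1 - Real.exp (b * x)) (Iio 0) P) :
    laplaceTransform (killedTail P q) b =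
      ENNReal.ofReal ((∫ x in Iio 0, (1 - Real.exp (b * x)) ∂P + q) / b) := by
  have hnonneg : 0 ≤ ∫ x in Iio 0, (1 - Real.exp (b * x)) ∂P :=
    setIntegral_nonneg measurableSet_Iio fun x hx => one_sub_exp_mul_nonneg hb.le (le_of_lt hx)
  have hmeas := (antitone_measure_Iio_neg P).measurable
  change laplaceTransform (fun y => P (Iio (-y)) + ENNReal.ofReal q) b = _
  rw [laplaceTransform_add hmeas, laplaceTransform_measure_Iio_neg hb hP,
    laplaceTransform_const hb, ← ENNReal.ofReal_mul hq, ← ENNReal.ofReal_add (by positivity)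
    (by positivity)]
  congr 1
  ring

theorem laplaceTransform_integratedTail [IsNegLevyMeasure P] (hb : 0 < b) :
    laplaceTransform (integratedTail P) b =
      ENNReal.ofReal ((∫ x in Ioo (-1) 0, (Real.exp (b * x) - 1 - b * x) ∂P) / b ^ 2) := by
  have hmeas : Measurable (Function.uncurry fun x y : ℝ => ENNReal.ofReal (-x - y)) :=
    ENNReal.measurable_ofReal.comp (measurable_fst.neg.sub measurable_snd)
  change laplaceTransform (fun y => ∫⁻ x in Ioo (-1) 0, ENNReal.ofReal (-x - y) ∂P) b = _
  rw [laplaceTransform_lintegral hmeas, ← integral_div, ofReal_integral_eq_lintegral_ofReal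
    ((integrableOn_exp_sub_one_sub hb.le).div_const _)
    (ae_of_all _ fun x => div_nonneg (exp_sub_one_sub_nonneg _) (by positivity))]
  refine setLIntegral_congr_fun measurableSet_Ioo fun x hx => ?_
  rw [laplaceTransform_ofReal_sub (neg_nonneg.2 hx.2.le) hb, neg_mul_neg, mul_neg, ← sub_eq_add_neg]

end Kernels

section Symbols

variable {P : Measure ℝ} [IsNegLevyMeasure P] {b d mu q : ℝ}

theorem ofReal_posPart (a : ℝ) : ENNReal.ofReal a⁺ = ENNReal.ofReal a := by
  rw [posPart_def, ← ENNReal.toReal_ofReal', ENNReal.ofReal_toReal ENNReal.ofReal_ne_top]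

theorem laplaceTransform_leftKernel (mu : ℝ) (hb : 0 < b) :
    laplaceTransform (leftKernel P mu) b = ENNReal.ofReal
      ((∫ x in Ioo (-1) 0, (Real.exp (b * x) - 1 - b * x) ∂P) / b ^ 2 + mu⁻ / b) := by
  have hJ : 0 ≤ ∫ x in Ioo (-1) 0, (Real.exp (b * x) - 1 - b * x) ∂P :=
    integral_nonneg fun x => exp_sub_one_sub_nonneg _
  change laplaceTransform (fun y => integratedTail P y + ENNReal.ofReal (-mu)) b = _
  rw [laplaceTransform_add (by fun_prop), laplaceTransform_integratedTail hb,
    laplaceTransform_const hb, ← ofReal_posPart (-mu), posPart_neg,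
    ← ENNReal.ofReal_mul (negPart_nonneg mu), mul_one_div,
    ← ENNReal.ofReal_add (by positivity) (div_nonneg (negPart_nonneg mu) hb.le)]

theorem laplaceTransform_rightKernel (mu : ℝ) (hq : 0 ≤ q) (hb : 0 < b) :
    laplaceTransform (rightKernel P mu q) b = ENNReal.ofReal
      (mu⁺ / b + (∫ x in Iic (-1), (1 - Real.exp (b * x)) ∂P + q) / b ^ 2) := by
  have hT : 0 ≤ ∫ x in Iic (-1), (1 - Real.exp (b * x)) ∂P :=
    setIntegral_nonneg measurableSet_Iic fun x (hx : x ≤ -1) =>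
      one_sub_exp_mul_nonneg hb.le (by linarith)
  have hlarge : Iio (0 : ℝ) ∩ Iic (-1) = Iic (-1) := inter_eq_right.2 (Iic_subset_Iio.2 (by simp))
  change laplaceTransform (fun y => ENNReal.ofReal mu +
    ((fun _ => 1) ⋆₊ killedTail (P.restrict (Iic (-1))) q) y) b = _
  rw [laplaceTransform_add measurable_const, laplaceTransform_const hb,
    laplaceTransform_halfLineConv measurable_const (by fun_prop), laplaceTransform_one hb,
    laplaceTransform_killedTail hq hb (integrableOn_Iic_one_sub_exp hb.le).integrable.integrableOn,
    Measure.restrict_restrict measurableSet_Iio, hlarge, ← ofReal_posPart mu,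
    ← ENNReal.ofReal_mul (posPart_nonneg mu), ← ENNReal.ofReal_mul (by positivity),
    ← ENNReal.ofReal_add (mul_nonneg (posPart_nonneg mu) (by positivity)) (by positivity)]
  congr 1
  field_simp

theorem laplaceExponent_eq_sq_mul_sub (d mu : ℝ) (hq : 0 ≤ q) (hb : 0 < b) :
    -mu * b + d * b ^ 2 + jumpExponent P b - q =
      b ^ 2 * (d + (laplaceTransform (leftKernel P mu) b).toReal -
        (laplaceTransform (rightKernel P mu q) b).toReal) := by
  have hJ : 0 ≤ ∫ x in Ioo (-1) 0, (Real.exp (b * x) - 1 - b * x) ∂P :=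
    integral_nonneg fun x => exp_sub_one_sub_nonneg _
  have hT : 0 ≤ ∫ x in Iic (-1), (1 - Real.exp (b * x)) ∂P :=
    setIntegral_nonneg measurableSet_Iic fun x (hx : x ≤ -1) =>
      one_sub_exp_mul_nonneg hb.le (by linarith)
  rw [laplaceTransform_leftKernel mu hb, laplaceTransform_rightKernel mu hq hb,
    ENNReal.toReal_ofReal (by have := negPart_nonneg mu; positivity),
    ENNReal.toReal_ofReal (by have := posPart_nonneg mu; positivity), jumpExponent_eq_sub hb.le]
  nth_rewrite 1 [← posPart_sub_negPart mu]
  field_simp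
  ring

theorem laplaceExponent_eq_mul_sub (hP : smallJumpVariation P ≠ ⊤) (mu : ℝ) (hq : 0 ≤ q)
    (hb : 0 < b) : -mu * b + jumpExponent P b - q =
      b * (-mu - ∫ x in Ioo (-1) 0, x ∂P - (laplaceTransform (killedTail P q) b).toReal) := by
  have hnonneg : 0 ≤ ∫ x in Iio 0, (1 - Real.exp (b * x)) ∂P :=
    setIntegral_nonneg measurableSet_Iio fun x hx => one_sub_exp_mul_nonneg hb.le (le_of_lt hx)
  rw [laplaceTransform_killedTail hq hb (integrableOn_Iio_one_sub_exp hP hb.le),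
    ENNReal.toReal_ofReal (by positivity), jumpExponent_eq_of_smallJumpVariation_ne_top hP hb.le]
  field_simp
  ring

theorem tendsto_rightKernel (P : Measure ℝ) [IsNegLevyMeasure P] (mu q : ℝ) :
    Tendsto (rightKernel P mu q) (𝓝[>] 0) (𝓝 (ENNReal.ofReal mu)) := by
  have hfin : (P.restrict (Iic (-1))) (Iio 0) + ENNReal.ofReal q ≠ ⊤ :=
    ENNReal.add_ne_top.2 ⟨((measure_mono (subset_univ _)).trans_lt
      ((Measure.restrict_apply_univ _).trans_lt
        (measure_Iic_lt_top_of_neg neg_one_lt_zero))).ne, ENNReal.ofReal_ne_top⟩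
  have hone : Tendsto (fun x : ℝ => ∫⁻ _ in Ioo 0 x, (1 : ℝ≥0∞)) (𝓝[>] 0) (𝓝 0) :=
    tendsto_setLIntegral_Ioo_nhdsGT one_pos (by simp)
  change Tendsto (fun y => ENNReal.ofReal mu +
    ((fun _ => 1) ⋆₊ killedTail (P.restrict (Iic (-1))) q) y) (𝓝[>] 0) (𝓝 (ENNReal.ofReal mu))
  simpa using (tendsto_halfLineConv_nhdsGT_zero measurable_const hone
    (tendsto_killedTail (P.restrict (Iic (-1))) q) hfin).const_add (ENNReal.ofReal mu)

theorem eventually_lt_of_gaussian (hd : 0 < d) (mu : ℝ) (hq : 0 ≤ q) :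
    ∀ᶠ b in atTop, q < -mu * b + d * b ^ 2 + jumpExponent P b := by
  have hfin : laplaceTransform (rightKernel P mu q) 1 ≠ ⊤ := by
    rw [laplaceTransform_rightKernel mu hq one_pos]
    exact ENNReal.ofReal_ne_top
  have hlim := (ENNReal.tendsto_toReal ENNReal.zero_ne_top).comp
    (tendsto_laplaceTransform_atTop (measurable_rightKernel P mu q) hfin)
  filter_upwards [hlim.eventually_lt_const hd, eventually_gt_atTop 0] with b hb hb0
  rw [← sub_pos, laplaceExponent_eq_sq_mul_sub d mu hq hb0]
  have hleft : 0 ≤ (laplaceTransform (leftKernel P mu) b).toReal := ENNReal.toReal_nonneg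
  exact mul_pos (pow_pos hb0 2) (by simp only [Function.comp_apply] at hb; linarith)

theorem eventually_lt_of_smallJumpVariation_ne_top (hP : smallJumpVariation P ≠ ⊤) (hq : 0 ≤ q)
    (hδ : 0 < -mu - ∫ x in Ioo (-1) 0, x ∂P) :
    ∀ᶠ b in atTop, q < -mu * b + jumpExponent P b := by
  have hfin : laplaceTransform (killedTail P q) 1 ≠ ⊤ := by
    rw [laplaceTransform_killedTail hq one_pos (integrableOn_Iio_one_sub_exp hP zero_le_one)]
    exact ENNReal.ofReal_ne_top
  have hlim := (ENNReal.tendsto_toReal ENNReal.zero_ne_top).comp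
    (tendsto_laplaceTransform_atTop (measurable_killedTail P q) hfin)
  filter_upwards [hlim.eventually_lt_const hδ, eventually_gt_atTop 0] with b hb hb0
  rw [← sub_pos, laplaceExponent_eq_mul_sub hP mu hq hb0]
  exact mul_pos hb0 (sub_pos.2 hb)

theorem exists_forall_lt_truncation (hP : smallJumpVariation P = ⊤) (mu : ℝ) (hq : 0 ≤ q) :
    ∃ ε₀ > 0, ∃ b₀ > 0, ∀ b ≥ b₀, ∀ ε ∈ Icc 0 ε₀,
      q < -mu * b + jumpExponent (truncation P ε) b := by
  obtain ⟨ε₀, hδ, hε₀⟩ := ((eventually_truncation_drift_pos hP mu).and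
    (Ioo_mem_nhdsGT one_pos)).exists
  obtain ⟨b₀, hb₀⟩ := eventually_atTop.1 ((eventually_gt_atTop 0).and
    (eventually_lt_of_smallJumpVariation_ne_top (smallJumpVariation_truncation_ne_top hε₀.1)
      hq hδ))
  refine ⟨ε₀, hε₀.1, b₀, (hb₀ b₀ le_rfl).1, fun b hb ε hε => ?_⟩
  have hle := antitoneOn_jumpExponent_truncation (P := P) (hb₀ b hb).1.le
    ⟨hε.1, hε.2.trans_lt hε₀.2⟩ ⟨hε₀.1.le, hε₀.2⟩ hε.2
  linarith [(hb₀ b hb).2]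

theorem laplaceTransform_renewalFunction_killedTail (hP : smallJumpVariation P ≠ ⊤) (hq : 0 ≤ q)
    (hb : 0 < b) (hψ : q < -mu * b + jumpExponent P b) :
    laplaceTransform (renewalFunction (ENNReal.ofReal (-mu - ∫ x in Ioo (-1) 0, x ∂P)⁻¹)
      (killedTail P q)) b = ENNReal.ofReal (1 / (-mu * b + jumpExponent P b - q)) := by
  have hk := laplaceTransform_killedTail hq hb (integrableOn_Iio_one_sub_exp hP hb.le)
  have hsymbol := laplaceExponent_eq_mul_sub hP mu hq hb
  rw [← sub_pos, hsymbol] at hψ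
  rw [hsymbol]
  exact laplaceTransform_renewalFunction_ofReal (measurable_killedTail P q) hb
    ENNReal.toReal_nonneg (sub_pos.1 (pos_of_mul_pos_right hψ hb.le))
    (ENNReal.ofReal_toReal (hk ▸ ENNReal.ofReal_ne_top)).symm

theorem monotoneOn_of_laplaceTransform_eq (hP : smallJumpVariation P = ⊤) (hq : 0 ≤ q)
    {w : ℝ → ℝ≥0∞} (hw : Measurable w) (hwc : ∀ x, 0 < x → ContinuousWithinAt w (Ioi x) x)
    (h : ∀ᶠ b in atTop,
      laplaceTransform w b = ENNReal.ofReal (1 / (-mu * b + jumpExponent P b - q))) :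
    MonotoneOn w (Ioi 0) := by
  obtain ⟨ε₀, hε₀, b₁, hb₁, hψ⟩ := exists_forall_lt_truncation hP mu hq
  obtain ⟨b₂, hb₂⟩ := eventually_atTop.1 h
  set b := max b₁ b₂
  obtain ⟨ε, -, hε, hε0⟩ := exists_seq_strictAnti_tendsto' hε₀
  have hε0 : Tendsto ε atTop (𝓝[>] 0) :=
    tendsto_nhdsWithin_iff.2 ⟨hε0, Eventually.of_forall fun n => (hε n).1⟩
  have hpos {t : ℝ} (ht : b ≤ t) : 0 < t := hb₁.trans_le ((le_max_left _ _).trans ht)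
  have happrox (n : ℕ) {t : ℝ} (ht : b ≤ t) := laplaceTransform_renewalFunction_killedTail
    (smallJumpVariation_truncation_ne_top (P := P) (hε n).1) hq (hpos ht)
    (hψ t ((le_max_left _ _).trans ht) (ε n) ⟨(hε n).1.le, (hε n).2.le⟩)
  refine monotoneOn_of_tendsto_laplaceTransform (l := atTop) (b := b)
    (fun n => renewalFunction_monotone _ _) hw (fun n => happrox n le_rfl ▸ ENNReal.ofReal_ne_top)
    (hb₂ b (le_max_right _ _) ▸ ENNReal.ofReal_ne_top) (fun j => ?_) hwc
  have hbj : b ≤ b + j := le_add_of_nonneg_right j.cast_nonneg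
  have hlim := hψ (b + j) ((le_max_left _ _).trans hbj) 0 (left_mem_Icc.2 hε₀.le)
  rw [jumpExponent_truncation_zero] at hlim
  simp only [happrox _ hbj]
  rw [hb₂ _ ((le_max_right _ _).trans hbj)]
  exact ENNReal.tendsto_ofReal (tendsto_const_nhds.div ((((tendsto_jumpExponent_truncation
    (hpos hbj).le).comp hε0).const_add _).sub_const q) (sub_pos.2 hlim).ne')

theorem mul_ofReal_one_div_eq_add {A r : ℝ≥0∞} {c D : ℝ} (hA : A ≠ ⊤) (hr : r ≠ ⊤) (hc : 0 < c)
    (hD : 0 < D) (h : D = c * (A.toReal - r.toReal)) :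
    A * ENNReal.ofReal (1 / D) = ENNReal.ofReal (1 / c) + r * ENNReal.ofReal (1 / D) := by
  lift A to NNReal using hA
  lift r to NNReal using hr
  simp only [ENNReal.coe_toReal] at h
  rw [← ENNReal.ofReal_coe_nnreal, ← ENNReal.ofReal_coe_nnreal, ← ENNReal.ofReal_mul A.coe_nonneg,
    ← ENNReal.ofReal_mul r.coe_nonneg, ← ENNReal.ofReal_add (by positivity) (by positivity)]
  congr 1
  field_simp
  linarith

end Symbols

namespace SpectrallyNegativeLevy

variable {X : SpectrallyNegativeLevy} {q : ℝ} {W : ℝ → ℝ}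

instance (X : SpectrallyNegativeLevy) : IsNegLevyMeasure X.jump :=
  ⟨X.jump_Ici, X.lintegral_jump_lt_top⟩

theorem laplaceExponent_eq (X : SpectrallyNegativeLevy) (b : ℝ) :
    X.laplaceExponent b = -X.mu * b + X.sigma ^ 2 / 2 * b ^ 2 + jumpExponent X.jump b := rfl

theorem laplaceExponent_eq_of_sigma_eq_zero (hσ : X.sigma = 0) (b : ℝ) :
    X.laplaceExponent b = -X.mu * b + jumpExponent X.jump b := by
  rw [laplaceExponent_eq, hσ]
  ring

theorem drift_pos (hσ : X.sigma = 0) (hP : smallJumpVariation X.jump ≠ ⊤) : 0 < X.drift :=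
  ((X.not_monotone.resolve_left (not_not.2 hσ)).resolve_left hP).1

theorem eventually_lt_laplaceExponent (X : SpectrallyNegativeLevy) (hq : 0 ≤ q) :
    ∀ᶠ b in atTop, q < X.laplaceExponent b := by
  by_cases hσ : X.sigma = 0
  · simp only [laplaceExponent_eq_of_sigma_eq_zero hσ]
    by_cases hP : smallJumpVariation X.jump = ⊤
    · obtain ⟨ε₀, hε₀, b₀, -, h⟩ := exists_forall_lt_truncation hP X.mu hq
      filter_upwards [eventually_ge_atTop b₀] with b hb
      simpa only [jumpExponent_truncation_zero] using h b hb 0 (left_mem_Icc.2 hε₀.le)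
    · exact eventually_lt_of_smallJumpVariation_ne_top hP hq (drift_pos hσ hP)
  · exact eventually_lt_of_gaussian (by positivity) X.mu hq

theorem tendsto_setLIntegral_leftKernel (X : SpectrallyNegativeLevy) :
    Tendsto (fun x => ∫⁻ y in Ioo 0 x, leftKernel X.jump X.mu y) (𝓝[>] 0) (𝓝 0) :=
  tendsto_setLIntegral_Ioo_nhdsGT one_pos <|
    setLIntegral_Ioo_ne_top_of_laplaceTransform_ne_top
      (laplaceTransform_leftKernel (P := X.jump) X.mu one_pos ▸ ENNReal.ofReal_ne_top) 1

theorem tendsto_setLIntegral_rightKernel (X : SpectrallyNegativeLevy) (hq : 0 ≤ q) :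
    Tendsto (fun x => ∫⁻ y in Ioo 0 x, rightKernel X.jump X.mu q y) (𝓝[>] 0) (𝓝 0) :=
  tendsto_setLIntegral_Ioo_nhdsGT one_pos <|
    setLIntegral_Ioo_ne_top_of_laplaceTransform_ne_top
      (laplaceTransform_rightKernel (P := X.jump) X.mu hq one_pos ▸ ENNReal.ofReal_ne_top) 1

namespace IsScaleFunction

theorem continuousWithinAt_Ioi (hW : X.IsScaleFunction q W) {x : ℝ} (hx : 0 ≤ x) :
    ContinuousWithinAt W (Ioi x) x :=
  continuousWithinAt_Ioi_iff_Ici.2 (hW.rightContinuous x hx)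

theorem continuousWithinAt_ofReal (hW : X.IsScaleFunction q W) {x : ℝ} (hx : 0 ≤ x) :
    ContinuousWithinAt (fun x => ENNReal.ofReal (W x)) (Ioi x) x :=
  ENNReal.tendsto_ofReal (hW.continuousWithinAt_Ioi hx)

theorem measurable (hW : X.IsScaleFunction q W) : Measurable W := by
  refine measurable_of_continuousWithinAt_Ioi fun x => ?_
  rcases le_or_gt 0 x with hx | hx
  · exact hW.continuousWithinAt_Ioi hx
  · refine ((continuousAt_const (y := (0 : ℝ))).congr ?_).continuousWithinAt
    filter_upwards [Iio_mem_nhds hx] with y hy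
    exact (hW.eq_zero_of_neg y hy).symm

theorem laplaceTransform_eq (hW : X.IsScaleFunction q W) {b : ℝ} (hb : X.rightInverse q < b) :
    laplaceTransform (fun x => ENNReal.ofReal (W x)) b =
      ENNReal.ofReal (1 / (X.laplaceExponent b - q)) := by
  rw [← hW.laplace_eq b hb, ofReal_integral_eq_lintegral_ofReal (hW.integrableOn b hb)
    (ae_of_all _ fun x => mul_nonneg (Real.exp_pos _).le (hW.nonneg x))]
  simp only [laplaceTransform, ENNReal.ofReal_mul (Real.exp_pos _).le]

theorem eventually_renewal_equation (hW : X.IsScaleFunction q W) (hq : 0 ≤ q) {a : ℝ≥0∞}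
    {f l r : ℝ → ℝ≥0∞} {g : ℝ → ℝ} (ha : a ≠ ⊤) (hf : Continuous f) (hl : Measurable l)
    (hr : Measurable r) (hg : ∀ b > 0, 0 < g b)
    (hfg : ∀ b > 0, laplaceTransform f b = ENNReal.ofReal (1 / g b))
    (hlb : ∀ b > 0, laplaceTransform l b ≠ ⊤) (hrb : ∀ b > 0, laplaceTransform r b ≠ ⊤)
    (hψ : ∀ b > 0, X.laplaceExponent b - q =
      g b * (a.toReal + (laplaceTransform l b).toReal - (laplaceTransform r b).toReal)) :
    ∀ᶠ x in 𝓝[>] 0, a * ENNReal.ofReal (W x) + (l ⋆₊ fun x => ENNReal.ofReal (W x)) x =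
      f x + (r ⋆₊ fun x => ENNReal.ofReal (W x)) x := by
  obtain ⟨b₀, hb₀⟩ := eventually_atTop.1 ((eventually_gt_atTop 0).and
    ((eventually_gt_atTop (X.rightInverse q)).and (X.eventually_lt_laplaceExponent hq)))
  obtain ⟨hb₀0, hb₀q, -⟩ := hb₀ b₀ le_rfl
  refine eventually_add_halfLineConv_eq_of_laplaceTransform_eq (b := b₀) ha
    hW.measurable.ennreal_ofReal ENNReal.ofReal_ne_top (fun x hx => hW.continuousWithinAt_ofReal hx)
    (hW.laplaceTransform_eq hb₀q ▸ ENNReal.ofReal_ne_top) hf hl (hlb b₀ hb₀0) hr (hrb b₀ hb₀0)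
    fun j => ?_
  obtain ⟨hb, hbq, hbψ⟩ := hb₀ (b₀ + j) (le_add_of_nonneg_right j.cast_nonneg)
  rw [hW.laplaceTransform_eq hbq, hfg _ hb]
  refine mul_ofReal_one_div_eq_add (ENNReal.add_ne_top.2 ⟨ha, hlb _ hb⟩) (hrb _ hb) (hg _ hb)
    (sub_pos.2 hbψ) ?_
  rw [hψ _ hb, ENNReal.toReal_add ha (hlb _ hb)]

theorem eventually_drift_mul_eq (hW : X.IsScaleFunction q W) (hq : 0 ≤ q) (hσ : X.sigma = 0)
    (hP : smallJumpVariation X.jump ≠ ⊤) :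
    ∀ᶠ x in 𝓝[>] 0, ENNReal.ofReal X.drift * ENNReal.ofReal (W x) =
      1 + (killedTail X.jump q ⋆₊ fun x => ENNReal.ofReal (W x)) x := by
  have hk (b : ℝ) (hb : 0 < b) : laplaceTransform (killedTail X.jump q) b ≠ ⊤ :=
    laplaceTransform_killedTail hq hb (integrableOn_Iio_one_sub_exp hP hb.le) ▸
      ENNReal.ofReal_ne_top
  have hzero (b : ℝ) : laplaceTransform (fun _ => 0) b = 0 := by simp [laplaceTransform]
  have h := hW.eventually_renewal_equation hq (l := fun _ => 0) (f := fun _ => 1) (g := id)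
    (ENNReal.ofReal_ne_top (r := X.drift)) continuous_const measurable_const
    (measurable_killedTail X.jump q) (fun _ => id) (fun b hb => laplaceTransform_one hb)
    (fun b _ => (hzero b).trans_ne ENNReal.zero_ne_top) hk fun b hb => ?_
  · filter_upwards [h] with x hx
    simpa [halfLineConv] using hx
  · rw [laplaceExponent_eq_of_sigma_eq_zero hσ, laplaceExponent_eq_mul_sub hP X.mu hq hb, hzero,
      ENNReal.toReal_ofReal (drift_pos hσ hP).le, ENNReal.toReal_zero, add_zero, drift, id]

theorem eventually_add_leftKernel_eq (hW : X.IsScaleFunction q W) (hq : 0 ≤ q) :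
    ∀ᶠ x in 𝓝[>] 0, ENNReal.ofReal (X.sigma ^ 2 / 2) * ENNReal.ofReal (W x) +
        (leftKernel X.jump X.mu ⋆₊ fun x => ENNReal.ofReal (W x)) x =
      ENNReal.ofReal x + (rightKernel X.jump X.mu q ⋆₊ fun x => ENNReal.ofReal (W x)) x := by
  refine hW.eventually_renewal_equation hq (g := fun b => b ^ 2) ENNReal.ofReal_ne_top
    ENNReal.continuous_ofReal (measurable_leftKernel _ _) (measurable_rightKernel _ _ _)
    (fun b hb => pow_pos hb 2) (fun b hb => laplaceTransform_ofReal hb)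
    (fun b hb => laplaceTransform_leftKernel (P := X.jump) X.mu hb ▸ ENNReal.ofReal_ne_top)
    (fun b hb => laplaceTransform_rightKernel (P := X.jump) X.mu hq hb ▸ ENNReal.ofReal_ne_top)
    fun b hb => ?_
  rw [laplaceExponent_eq, laplaceExponent_eq_sq_mul_sub _ X.mu hq hb,
    ENNReal.toReal_ofReal (by positivity)]

theorem tendsto_ofReal (hW : X.IsScaleFunction q W) :
    Tendsto (fun x => ENNReal.ofReal (W x)) (𝓝[>] 0) (𝓝 (ENNReal.ofReal (W 0))) :=
  hW.continuousWithinAt_ofReal le_rfl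

theorem tendsto_of_sigma_ne_zero (hW : X.IsScaleFunction q W) (hq : 0 ≤ q) (hσ : X.sigma ≠ 0) :
    Tendsto (fun x => (W x - W 0) / x) (𝓝[>] 0) (𝓝 (2 / X.sigma ^ 2)) := by
  have hd : 0 < X.sigma ^ 2 / 2 := by positivity
  have hslope := tendsto_div_of_mul_add_halfLineConv_eq (ENNReal.ofReal_pos.2 hd).ne'
    ENNReal.ofReal_ne_top (measurable_leftKernel X.jump X.mu) X.tendsto_setLIntegral_leftKernel
    (measurable_rightKernel X.jump X.mu q) (X.tendsto_setLIntegral_rightKernel hq)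
    hW.tendsto_ofReal ENNReal.ofReal_ne_top (hW.eventually_add_leftKernel_eq hq)
  rw [← ENNReal.ofReal_inv_of_pos hd, inv_div] at hslope
  have hW0 : ENNReal.ofReal (W 0) = 0 :=
    eq_zero_of_tendsto_div hW.tendsto_ofReal ENNReal.ofReal_ne_top hslope
  refine tendsto_div_of_tendsto_ofReal_sub_div (hW.nonneg 0) (by positivity)
    (Eventually.of_forall fun x => ?_) (by simpa only [hW0, tsub_zero] using hslope)
  exact (ENNReal.ofReal_eq_zero.1 hW0).trans (hW.nonneg x)

section BoundedVariation

variable (hW : X.IsScaleFunction q W) (hq : 0 ≤ q) (hσ : X.sigma = 0)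
  (hP : smallJumpVariation X.jump ≠ ⊤)

include hW hq hσ hP

theorem ofReal_apply_zero : ENNReal.ofReal (W 0) = (ENNReal.ofReal X.drift)⁻¹ := by
  have hk := laplaceTransform_killedTail hq one_pos (integrableOn_Iio_one_sub_exp hP zero_le_one)
  exact eq_inv_of_mul_eq_one_add_halfLineConv ENNReal.ofReal_ne_top (measurable_killedTail _ q)
    (tendsto_setLIntegral_Ioo_nhdsGT one_pos
      (setLIntegral_Ioo_ne_top_of_laplaceTransform_ne_top (hk ▸ ENNReal.ofReal_ne_top) 1))
    hW.tendsto_ofReal ENNReal.ofReal_ne_top (hW.eventually_drift_mul_eq hq hσ hP)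

theorem tendsto_ofReal_sub_div :
    Tendsto (fun x => (ENNReal.ofReal (W x) - ENNReal.ofReal (W 0)) / ENNReal.ofReal x) (𝓝[>] 0)
      (𝓝 ((X.jump (Iio 0) + ENNReal.ofReal q) / ENNReal.ofReal X.drift ^ 2)) := by
  have hlim := hW.tendsto_ofReal
  have hW0 := hW.ofReal_apply_zero hq hσ hP
  rw [hW0] at hlim ⊢
  exact tendsto_sub_div_of_mul_eq_one_add_halfLineConv (ENNReal.ofReal_pos.2 (drift_pos hσ hP)).ne'
    ENNReal.ofReal_ne_top (measurable_killedTail _ q) (tendsto_killedTail _ q) hlim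
    (hW.eventually_drift_mul_eq hq hσ hP)

theorem eventually_apply_zero_le : ∀ᶠ x in 𝓝[>] 0, W 0 ≤ W x := by
  filter_upwards [hW.eventually_drift_mul_eq hq hσ hP] with x hx
  rw [← ENNReal.ofReal_le_ofReal_iff (hW.nonneg x), hW.ofReal_apply_zero hq hσ hP]
  exact (ENNReal.inv_le_iff_le_mul (absurd · ENNReal.ofReal_ne_top)
    (absurd · ENNReal.ofReal_ne_top)).2 (hx ▸ le_self_add)

end BoundedVariation

theorem tendsto_of_measure_Iio_lt_top (hW : X.IsScaleFunction q W) (hq : 0 ≤ q)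
    (hσ : X.sigma = 0) (hfin : X.jump (Iio 0) < ⊤) :
    Tendsto (fun x => (W x - W 0) / x) (𝓝[>] 0)
      (𝓝 (((X.jump (Iio 0)).toReal + q) / X.drift ^ 2)) := by
  have hP := smallJumpVariation_ne_top_of_measure_Iio_lt_top hfin
  have hδ := drift_pos hσ hP
  have hlim := hW.tendsto_ofReal_sub_div hq hσ hP
  rw [← ENNReal.ofReal_toReal hfin.ne, ← ENNReal.ofReal_add ENNReal.toReal_nonneg hq,
    ← ENNReal.ofReal_pow hδ.le, ← ENNReal.ofReal_div_of_pos (by positivity)] at hlim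
  exact tendsto_div_of_tendsto_ofReal_sub_div (hW.nonneg 0) (by positivity)
    (hW.eventually_apply_zero_le hq hσ hP) hlim

theorem tendsto_atTop_of_smallJumpVariation_ne_top (hW : X.IsScaleFunction q W) (hq : 0 ≤ q)
    (hσ : X.sigma = 0) (hP : smallJumpVariation X.jump ≠ ⊤) (hinf : X.jump (Iio 0) = ⊤) :
    Tendsto (fun x => (W x - W 0) / x) (𝓝[>] 0) atTop := by
  have hlim := hW.tendsto_ofReal_sub_div hq hσ hP
  rw [hinf, top_add, ENNReal.top_div_of_ne_top (by finiteness)] at hlim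
  exact tendsto_div_atTop_of_tendsto_ofReal_sub_div (hW.nonneg 0) hlim

theorem tendsto_atTop_of_smallJumpVariation_eq_top (hW : X.IsScaleFunction q W) (hq : 0 ≤ q)
    (hσ : X.sigma = 0) (hP : smallJumpVariation X.jump = ⊤) :
    Tendsto (fun x => (W x - W 0) / x) (𝓝[>] 0) atTop := by
  have heq : ∀ᶠ x in 𝓝[>] 0, (leftKernel X.jump X.mu ⋆₊ fun x => ENNReal.ofReal (W x)) x =
      ENNReal.ofReal x + (rightKernel X.jump X.mu q ⋆₊ fun x => ENNReal.ofReal (W x)) x := by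
    simpa [hσ] using hW.eventually_add_leftKernel_eq hq
  have hmono : MonotoneOn (fun x => ENNReal.ofReal (W x)) (Ioi 0) := by
    refine monotoneOn_of_laplaceTransform_eq hP hq hW.measurable.ennreal_ofReal
      (fun x hx => hW.continuousWithinAt_ofReal hx.le) (mu := X.mu) ?_
    filter_upwards [eventually_gt_atTop (X.rightInverse q)] with b hb
    rw [hW.laplaceTransform_eq hb, laplaceExponent_eq_of_sigma_eq_zero hσ]
  have hW0 : ENNReal.ofReal (W 0) = 0 :=
    eq_zero_of_halfLineConv_eq (measurable_leftKernel _ _) (tendsto_leftKernel_top hP _)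
      (measurable_rightKernel _ _ _) (tendsto_rightKernel _ _ _) ENNReal.ofReal_ne_top
      hW.tendsto_ofReal ENNReal.ofReal_ne_top heq
  refine tendsto_div_atTop_of_tendsto_ofReal_sub_div (hW.nonneg 0) ?_
  simp only [hW0, tsub_zero]
  exact tendsto_div_top_of_ofReal_le_halfLineConv (measurable_leftKernel _ _)
    X.tendsto_setLIntegral_leftKernel hmono (heq.mono fun x hx => hx ▸ le_self_add)

theorem tendsto_atTop (hW : X.IsScaleFunction q W) (hq : 0 ≤ q) (hσ : X.sigma = 0)
    (hinf : X.jump (Iio 0) = ⊤) : Tendsto (fun x => (W x - W 0) / x) (𝓝[>] 0) atTop := by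
  by_cases hP : smallJumpVariation X.jump = ⊤
  · exact hW.tendsto_atTop_of_smallJumpVariation_eq_top hq hσ hP
  · exact hW.tendsto_atTop_of_smallJumpVariation_ne_top hq hσ hP hinf

end IsScaleFunction

end SpectrallyNegativeLevy

end

theorem mainTheorem7 (X : SpectrallyNegativeLevy) (q : ℝ) (hq : 0 ≤ q) (W : ℝ → ℝ)
    (hW : X.IsScaleFunction q W) :
    (X.sigma ≠ 0 →
      Tendsto (fun x => (W x - W 0) / x) (𝓝[>] 0) (𝓝 (2 / X.sigma ^ 2))) ∧
    (X.sigma = 0 → X.jump (Iio 0) = ⊤ →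
      Tendsto (fun x => (W x - W 0) / x) (𝓝[>] 0) atTop) ∧
    (X.sigma = 0 → X.jump (Iio 0) < ⊤ →
      Tendsto (fun x => (W x - W 0) / x) (𝓝[>] 0)
        (𝓝 (((X.jump (Iio 0)).toReal + q) / X.drift ^ 2))) :=
  ⟨hW.tendsto_of_sigma_ne_zero hq, hW.tendsto_atTop hq, hW.tendsto_of_measure_Iio_lt_top hq⟩
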